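/- For integers $q\ge 2$ and $0\le r<q$ and a finite graph $G$, an $(r,q)$-partition of $G$ is a partition $V(G)=V_1\cup\dots\cup V_k$ into nonempty parts such that, for every $i$, all degrees in the induced subgraph $G[V_i]$ are congruent to $r$ modulo $q$. Let $p(G,r,q)$ be the least number $k$ of parts of an $(r,q)$-partition of $G$, with $p(G,r,q)=\infty$ if there is none. Let $G_{n,1/2}$ be the random graph on $n$ vertices in which each pair of vertices is an edge independently with probability $1/2$. **Theorem 3.** Fix integers $q\ge 2$ and $0\le r<q$. If $q$ is even and $r$ is odd, let $n$ run over the even integers only (for odd $n$ no $(r,q)$-partition exists, by parity) and put $d=2$; otherwise let $n$ run over all positive integers and put $d=1$. Then, with probability tending to $1$ as $n\to\infty$, $G_{n,1/2}$ has an $(r,q)$-partition into exactly $q+1$ parts, each of size $d\lfloor \frac{n}{d(q+1)}\rfloor$ or $d\lceil \frac{n}{d(q+1)}\rceil$. (Thus the part sizes differ by at most $1$ when $d=1$; when $d=2$ they are all even, as they must be, and differ by at most $2$.) Hence, with probability tending to $1$ as $n\to\infty$ over the same $n$, $p(G_{n,1/2},r,q)\le q+1$; in particular $p(G_{n,1/2},r,q)$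 is bounded with high probability by a constant depending only on $q$, as conjectured by Scott. -/

import Mathlib

open Filter Topology
open scoped Finset

/-- The induced subgraph `G[A]` has all its degrees congruent to `r` modulo `q`. -/
def InducesDegreesMod {V : Type*} [Fintype V] (G : SimpleGraph V) (r q : ℕ) (A : Finset V) : Prop :=
  open Classical in
  ∀ v : (A : Set V), (G.induce (A : Set V)).degree v ≡ r [MOD q]

/-- A partition `V = V₁ ∪ ⋯ ∪ V_k` (into nonempty, pairwise disjoint parts) is an
`(r, q)`-partition of `G` if all degrees in each `G[V_i]` are congruent to `r` modulo `q`. -/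
def IsRQPartition {V : Type*} [Fintype V] [DecidableEq V] (G : SimpleGraph V) (r q : ℕ)
    (P : Finpartition (Finset.univ : Finset V)) : Prop :=
  ∀ A ∈ P.parts, InducesDegreesMod G r q A

/-- `p(G, r, q)`: the least number of parts in an `(r, q)`-partition of `G`, and `⊤` if `G` has no
`(r, q)`-partition. -/
noncomputable def partitionNumber {V : Type*} [Fintype V] [DecidableEq V] (G : SimpleGraph V)
    (r q : ℕ) : ℕ∞ :=
  sInf {k : ℕ∞ | ∃ P : Finpartition (Finset.univ : Finset V),
    IsRQPartition G r q P ∧ (#P.parts : ℕ∞) = k}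

/-- The divisor that parity forces on the order of a graph with all degrees `≡ r (mod q)`: if `q` is
even and `r` is odd, all degrees are odd, so the order is even; otherwise nothing is forced. -/
def parityStep (q r : ℕ) : ℕ := if Even q ∧ Odd r then 2 else 1

/-- A partition of an `n`-set into `t` parts is balanced in multiples of `d` if every part
has size `d⌊n / (dt)⌋` or `d⌈n / (dt)⌉`. For `d = 1` this is the usual notion: every part has size
`⌊n / t⌋` or `⌈n / t⌉`. -/
def IsBalancedPartition {V : Type*} [Fintype V] [DecidableEq V] (d : ℕ)
    (P : Finpartition (Finset.univ : Finset V)) : Prop :=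
  ∀ A ∈ P.parts,
    #A = d * ⌊(Fintype.card V : ℚ) / (d * #P.parts)⌋₊ ∨
    #A = d * ⌈(Fintype.card V : ℚ) / (d * #P.parts)⌉₊

/-- The law of the random graph `G_{n, 1/2}` on the vertex set `Fin n`. -/
noncomputable def randomGraphHalf (n : ℕ) : MeasureTheory.Measure (SimpleGraph (Fin n)) :=
  SimpleGraph.binomialRandom (Fin n) ⟨1 / 2, by norm_num, by norm_num⟩

/-!
The proof is a second moment argument, in which every probability is computed by Fourier analysis
over `ZMod q`.

Fix class sizes `m i` within `2` of `n / (q + 1)`, all even if `q` is even and `r` is odd, and let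
`F` be the set of colourings `Fin n → Fin (q + 1)` with these class sizes. Call a colouring good if
all degrees inside its classes are `≡ r (mod q)`. The claim is that some colouring in `F` is good
with probability tending to `1`. One has `#F ≥ (q + 1) ^ n / poly(n)`, while a given colouring is
good with probability of order `q ^ (-n)`, so the expected number of good colourings is
exponentially large.

*Probabilities.* For a family `A : J → Finset V`, expand the indicator of "`deg_{A j} v ≡ r` for all
`v ∈ A j`" in additive characters, one frequency `x (v, j)` for each condition. The mean over the
random graph factors over the pairs `uv` (`graphProb_mul_pow`): the factor of `uv` is `(1 + e(s)) /
2`, where `s` is the sum of `x (u, j) + x (v, j)` over the `j` with `u, v ∈ A j`. It has norm at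
most some `ρ < 1` unless `s = 0`. Give each vertex a type (the `j` with `v ∈ A j`, and the
frequencies at `v`), call a type large if it occurs linearly often, and call a vertex bad if its
type has nonzero weight with some large type. Each bad vertex lies on linearly many pairs with `s ≠
0`, so a term with `k` bad vertices is at most `ρ ^ (c n k)`. If every vertex `v ∈ A j` has linearly
many `u ∈ A j` that share with `v` only the index `j`, then some of these `u` have a large type, and
`x (v, j)` is forced at each vertex that is not bad. Hence the terms with `k` bad vertices number at
most `O(1) * n.choose k * O(1) ^ k`, and the terms with `k ≥ 1` contribute `o(1)` altogether. So the
probability is `O(q ^ (-∑ #(A j)))` (`exists_graphProb_mul_pow_le`). Under a slightly stronger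
condition the terms with no bad vertex are exactly those with `x (·, j)` constant on `A j` with
value in the two-torsion of `ZMod q`; each of them equals `1`, which gives the asymptotic value
(`eventually_abs_graphProb_mul_pow_sub_le`).

*Pairs of colourings.* If all intersections of a class of `χ` with a class of `χ'` have linear size,
the asymptotics for the family of all these classes show that the events "`χ` is good" and "`χ'` is
good" are asymptotically independent; three classes are needed here, hence `q ≥ 2`. All other pairs
form a vanishing proportion (`exists_eventually_card_not_crossWell_le`). Those for which no class of
`χ'` nearly coincides with a class of `χ` have probability `O(q ^ (-2 n))`, so they do not matter.
If `S ≠ ∅` is the set of colours of `χ'` whose class nearly coincides with a class of `χ`, drop the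
conditions on these classes: the probability is `O(q ^ (-n - k))`, where `k` is the number of
vertices with `χ'`-colour outside `S`. There are at most `q ^ k * μ ^ n` such `χ'`, since only `q`
colours are left for these `k` vertices (`card_nearColors_eq_le`). Such pairs contribute at most `#F
* q ^ (-n) * μ ^ n`, with a factor `μ > 1` as close to `1` as desired, which is negligible against
`(#F * q ^ (-n)) ^ 2` because `#F` grows faster than `(q * μ) ^ n`. The Cauchy-Schwarz inequality
(`sq_sum_graphProb_le`) concludes.
-/

/-! ### Fourier expansion of the degree conditions -/

section Fourier

variable {V J : Type*} [Fintype V] [LinearOrder V] [Fintype J] [DecidableEq J]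

/-- For each member `A j` of the family, all degrees in the subgraph of `G` induced on `A j` are
congruent to `r` modulo `q`. -/
def FamilyDegreesMod (G : SimpleGraph V) (q r : ℕ) (A : J → Finset V) : Prop :=
  open Classical in
  ∀ j, ∀ v ∈ A j, ((#{u ∈ A j | G.Adj v u} : ℕ) : ZMod q) = r

/-- The total coefficient of the edge `uv` in `∑ (v, j), x (v, j) * deg_{A j} v`, for a vector `x`
of frequencies that vanishes at `(v, j)` if `v ∉ A j`. -/
def pairWeight {q : ℕ} (A : J → Finset V) (x : V × J → ZMod q) (u v : V) : ZMod q :=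
  ∑ j, if u ∈ A j ∧ v ∈ A j then x (u, j) + x (v, j) else 0

omit [Fintype V] [DecidableEq J] in
lemma pairWeight_comm {q : ℕ} (A : J → Finset V) (x : V × J → ZMod q) (u v : V) :
    pairWeight A x u v = pairWeight A x v u := by
  unfold pairWeight
  refine Finset.sum_congr rfl fun j _ => ?_
  simp only [and_comm, add_comm]

/-- The vectors of frequencies: one frequency for each pair `(v, j)` with `v ∈ A j`, extended by `0`
to all pairs. -/
def supportedVectors (q : ℕ) [NeZero q] (A : J → Finset V) : Finset (V × J → ZMod q) :=
  Fintype.piFinset fun p => if p.1 ∈ A p.2 then Finset.univ else {0}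

lemma mem_supportedVectors {q : ℕ} [NeZero q] {A : J → Finset V} {x : V × J → ZMod q} :
    x ∈ supportedVectors q A ↔ ∀ v j, v ∉ A j → x (v, j) = 0 := by
  simp only [supportedVectors, Fintype.mem_piFinset, Prod.forall]
  refine forall_congr' fun v => forall_congr' fun j => ?_
  by_cases h : v ∈ A j <;> simp [h]

/-- Summing over all graphs factors over the pairs of vertices: every non-diagonal pair is either
a non-edge (factor `1`) or an edge (factor `h e`). -/
lemma sum_graph_prod_edges (h : Sym2 V → ℂ) :
    open Classical in
    ∑ G : SimpleGraph V, ∏ e ∈ G.edgeFinset, h e =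
      ∏ e : Sym2 V with ¬ e.IsDiag, (1 + h e) := by
  classical
  rw [Finset.prod_one_add]
  refine Finset.sum_bij' (fun G _ => G.edgeFinset)
    (fun t _ => SimpleGraph.fromEdgeSet (t : Set (Sym2 V))) ?_ ?_ ?_ ?_ ?_
  · intro G _
    rw [Finset.mem_powerset]
    intro e he
    simpa using G.not_isDiag_of_mem_edgeFinset he
  · simp
  · intro G _
    simp
  · intro t ht
    ext e
    simp only [SimpleGraph.mem_edgeFinset, SimpleGraph.edgeSet_fromEdgeSet]
    constructor
    · intro h; exact h.1
    · intro h
      refine ⟨h, ?_⟩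
      have := Finset.mem_powerset.1 ht h
      simpa using this
  · intro G _
    rfl

lemma sum_adj_eq_sum_edgeFinset {M : Type*} [AddCommMonoid M] (G : SimpleGraph V) (F : V → V → M)
    (f : Sym2 V → M) (hf : ∀ u v, f s(u, v) = F u v + F v u) :
    open Classical in
    ∑ v, ∑ u, (if G.Adj v u then F v u else 0) = ∑ e ∈ G.edgeFinset, f e := by
  classical
  have h1 : ∑ e ∈ G.edgeFinset, f e = ∑ e ∈ Finset.univ.sym2 with ¬ e.IsDiag,
      if e ∈ G.edgeFinset then f e else 0 := by
    rw [← Finset.sum_filter]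
    refine Finset.sum_congr ?_ fun _ _ => rfl
    ext e
    simp only [Finset.mem_filter, Finset.sym2_univ, Finset.mem_univ, true_and]
    exact ⟨fun h => ⟨G.not_isDiag_of_mem_edgeFinset h, h⟩, fun h => h.2⟩
  rw [h1, Finset.sum_sym2_filter_not_isDiag]
  have h2 : ∑ v, ∑ u, (if G.Adj v u then F v u else 0) =
      ∑ p ∈ Finset.univ.offDiag, if G.Adj p.1 p.2 then F p.1 p.2 else 0 := by
    rw [← Finset.sum_product', ← Finset.diag_union_offDiag, Finset.sum_union
      (Finset.disjoint_diag_offDiag _)]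
    simp [Finset.sum_diag]
  rw [h2, ← Finset.sum_filter_add_sum_filter_not _ (fun p : V × V => p.1 < p.2)]
  have h3 : ∑ p ∈ Finset.univ.offDiag with ¬ p.1 < p.2,
      (if G.Adj p.1 p.2 then F p.1 p.2 else 0) = ∑ p ∈ Finset.univ.offDiag with p.1 < p.2,
      (if G.Adj p.1 p.2 then F p.2 p.1 else 0) := by
    refine Finset.sum_bij' (fun p _ => p.swap) (fun p _ => p.swap) ?_ ?_ ?_ ?_ ?_
    · rintro ⟨a, b⟩ h
      simp at h ⊢
      exact ⟨Ne.symm h.1, lt_of_le_of_ne h.2 (Ne.symm h.1)⟩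
    · rintro ⟨a, b⟩ h
      simp at h ⊢
      exact ⟨Ne.symm h.1, h.2.le⟩
    · simp
    · simp
    · rintro ⟨a, b⟩ h
      simp [G.adj_comm]
  rw [h3, ← Finset.sum_add_distrib]
  refine Finset.sum_congr rfl fun p _ => ?_
  simp only [SimpleGraph.mem_edgeFinset, SimpleGraph.mem_edgeSet, hf]
  split_ifs <;> simp

/-- The mean of `ZMod.stdAddChar (s * z)` over a fair bit `z ∈ {0, 1}`. -/
noncomputable def edgeFactor {q : ℕ} [NeZero q] (s : ZMod q) : ℂ := (1 + ZMod.stdAddChar s) / 2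

/-- `pairWeight` as a function of the unordered pair. -/
def edgeWeight {q : ℕ} (A : J → Finset V) (x : V × J → ZMod q) : Sym2 V → ZMod q :=
  Sym2.lift ⟨pairWeight A x, pairWeight_comm A x⟩

lemma card_graph_eq : (Fintype.card (SimpleGraph V) : ℂ) =
    ∏ e : Sym2 V with ¬ e.IsDiag, (2 : ℂ) := by
  have := sum_graph_prod_edges (V := V) (fun _ => 1)
  simp only [Finset.prod_const_one, Finset.sum_const, Finset.card_univ, nsmul_eq_mul,
    mul_one] at this
  rw [this]
  norm_num

lemma sum_stdAddChar_mul {q : ℕ} [NeZero q] (b : ZMod q) :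
    ∑ a : ZMod q, ZMod.stdAddChar (a * b) = if b = 0 then (q : ℂ) else 0 := by
  have := AddChar.sum_mulShift b (ZMod.isPrimitive_stdAddChar q)
  rw [this, ZMod.card]
  split_ifs <;> simp

lemma AddChar.map_sum_prod {ι R M : Type*} [AddCommMonoid R] [CommMonoid M] (ψ : AddChar R M)
    (s : Finset ι) (f : ι → R) : ψ (∑ i ∈ s, f i) = ∏ i ∈ s, ψ (f i) := by
  classical
  induction s using Finset.induction_on with
  | empty => simp
  | insert a s ha ih => rw [Finset.sum_insert ha, Finset.prod_insert ha, AddChar.map_add_eq_mul, ih]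

/-- Orthogonality of characters, for all conditions `deg_{A j} v ≡ r` at once. -/
lemma indicator_mul_pow {q : ℕ} [NeZero q] (r : ℕ) (A : J → Finset V) (G : SimpleGraph V) :
    open Classical in
    (if FamilyDegreesMod G q r A then (1 : ℂ) else 0) * (q : ℂ) ^ (∑ j, #(A j)) =
      ∑ x ∈ supportedVectors q A, ZMod.stdAddChar (-(r : ZMod q) * ∑ p, x p) *
        ∏ e ∈ G.edgeFinset, ZMod.stdAddChar (edgeWeight A x e) := by
  classical
  let D : V × J → ZMod q := fun p => ((#{u ∈ A p.2 | G.Adj p.1 u} : ℕ) : ZMod q)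
  have h1 : ∏ p : V × J, ∑ a ∈ (if p.1 ∈ A p.2 then (Finset.univ : Finset (ZMod q)) else {0}),
      (ZMod.stdAddChar (a * (D p - (r : ZMod q))) : ℂ) =
      (if FamilyDegreesMod G q r A then (1 : ℂ) else 0) * (q : ℂ) ^ (∑ j, #(A j)) := by
    have h2 : ∀ p : V × J, ∑ a ∈ (if p.1 ∈ A p.2 then (Finset.univ : Finset (ZMod q)) else {0}),
      (ZMod.stdAddChar (a * (D p - (r : ZMod q))) : ℂ) =
        (if (p.1 ∈ A p.2 → D p = r) then 1 else 0) *
        (if p.1 ∈ A p.2 then (q : ℂ) else 1) := by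
      intro p
      by_cases hp : p.1 ∈ A p.2
      · simp only [hp, if_true, sum_stdAddChar_mul, sub_eq_zero, true_imp_iff]
        split_ifs <;> simp
      · simp [hp]
    rw [Finset.prod_congr rfl fun p _ => h2 p, Finset.prod_mul_distrib]
    congr 1
    · rw [Finset.prod_ite_zero]
      simp only [Finset.prod_const_one, Finset.mem_univ, true_imp_iff]
      congr 1
      simp only [FamilyDegreesMod, Prod.forall, D, eq_iff_iff]
      exact ⟨fun h j v hv => h v j hv, fun h v j hv => h j v hv⟩
    · rw [Fintype.prod_prod_type_right, ← Finset.prod_pow_eq_pow_sum]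
      refine Finset.prod_congr rfl fun j _ => ?_
      simp
  rw [← h1, Finset.prod_univ_sum]
  refine Finset.sum_congr rfl fun x hx => ?_
  change x ∈ supportedVectors q A at hx
  rw [mem_supportedVectors] at hx
  rw [← AddChar.map_sum_prod, ← AddChar.map_sum_prod, ← AddChar.map_add_eq_mul]
  congr 1
  rw [← sum_adj_eq_sum_edgeFinset G
    (fun v u => ∑ j, if v ∈ A j ∧ u ∈ A j then x (v, j) else 0)]
  · simp only [mul_sub, Finset.sum_sub_distrib, ← Finset.sum_mul]
    rw [neg_mul, mul_comm (r : ZMod q), neg_add_eq_sub]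
    congr 1
    rw [Fintype.sum_prod_type]
    refine Finset.sum_congr rfl fun v _ => ?_
    have h4 : ∀ u, (if G.Adj v u then ∑ j, (if v ∈ A j ∧ u ∈ A j then x (v, j) else 0) else 0) =
        ∑ j, if u ∈ A j ∧ G.Adj v u then x (v, j) else 0 := by
      intro u
      split_ifs with h
      · refine Finset.sum_congr rfl fun j _ => ?_
        by_cases hv : v ∈ A j
        · simp [hv, h]
        · simp [hx v j hv]
      · simp [h]
    rw [Finset.sum_congr rfl fun u _ => h4 u, Finset.sum_comm]
    refine Finset.sum_congr rfl fun j _ => ?_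
    have h5 : ({u | u ∈ A j ∧ G.Adj v u} : Finset V) = {u ∈ A j | G.Adj v u} := by
      ext u; simp
    rw [← Finset.sum_filter, Finset.sum_const, nsmul_eq_mul, h5, mul_comm]
  · intro u v
    simp only [edgeWeight, Sym2.lift_mk, pairWeight, ← Finset.sum_add_distrib]
    refine Finset.sum_congr rfl fun j _ => ?_
    by_cases h1 : u ∈ A j <;> by_cases h2 : v ∈ A j <;> simp [h1, h2]

/-- The proportion of the graphs on `V` that satisfy `p`. -/
noncomputable def graphProb (p : SimpleGraph V → Prop) : ℝ :=
  open Classical in (#{G : SimpleGraph V | p G} : ℝ) / Fintype.card (SimpleGraph V)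

theorem graphProb_mul_pow {q : ℕ} [NeZero q] (r : ℕ) (A : J → Finset V) :
    ((graphProb (fun G => FamilyDegreesMod G q r A) * (q : ℝ) ^ (∑ j, #(A j)) : ℝ) : ℂ) =
      ∑ x ∈ supportedVectors q A, ZMod.stdAddChar (-(r : ZMod q) * ∑ p, x p) *
        ∏ e : Sym2 V with ¬ e.IsDiag, edgeFactor (edgeWeight A x e) := by
  classical
  have h1 : ((#{G : SimpleGraph V | FamilyDegreesMod G q r A} : ℕ) : ℂ) * (q : ℂ) ^ (∑ j, #(A j)) =
      ∑ x ∈ supportedVectors q A, ZMod.stdAddChar (-(r : ZMod q) * ∑ p, x p) *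
        ∏ e : Sym2 V with ¬ e.IsDiag, (1 + ZMod.stdAddChar (edgeWeight A x e)) := by
    rw [Finset.natCast_card_filter, Finset.sum_mul,
      Finset.sum_congr rfl fun G _ => indicator_mul_pow r A G, Finset.sum_comm]
    refine Finset.sum_congr rfl fun x _ => ?_
    rw [← Finset.mul_sum, ← sum_graph_prod_edges]
  have hc : (Fintype.card (SimpleGraph V) : ℂ) ≠ 0 := by
    exact_mod_cast Fintype.card_ne_zero
  push_cast [graphProb]
  rw [div_mul_eq_mul_div, div_eq_iff hc]
  convert h1
  rw [Finset.sum_mul]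
  refine Finset.sum_congr rfl fun x _ => ?_
  rw [mul_assoc, card_graph_eq, ← Finset.prod_mul_distrib]
  congr 1
  refine Finset.prod_congr rfl fun e _ => ?_
  simp [edgeFactor]

end Fourier

/-! ### The factor of a single pair -/

section Factor

variable {q : ℕ} [NeZero q]

lemma edgeFactor_zero : edgeFactor (0 : ZMod q) = 1 := by
  simp [edgeFactor]

lemma norm_edgeFactor_le_one (s : ZMod q) : ‖edgeFactor s‖ ≤ 1 := by
  have : ‖(1 : ℂ) + ZMod.stdAddChar s‖ ≤ 2 := by
    refine (norm_add_le _ _).trans ?_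
    rw [AddChar.norm_apply]; norm_num
  rw [edgeFactor, norm_div]
  norm_num
  linarith

lemma norm_edgeFactor_lt_one {s : ZMod q} (hs : s ≠ 0) : ‖edgeFactor s‖ < 1 := by
  have h1 : ‖(ZMod.stdAddChar s : ℂ)‖ = 1 := AddChar.norm_apply _ _
  have h2 : (1 : ℂ) ≠ ZMod.stdAddChar s := by
    intro h
    apply hs
    apply ZMod.injective_stdAddChar
    rw [← h, AddChar.map_zero_eq_one]
  have h3 : ¬ SameRay ℝ (1 : ℂ) (ZMod.stdAddChar s) := by
    rw [sameRay_iff_of_norm_eq (by rw [h1, norm_one])]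
    exact h2
  have h4 := norm_add_lt_of_not_sameRay h3
  rw [h1, norm_one] at h4
  rw [edgeFactor, norm_div]
  norm_num
  linarith

lemma exists_edgeFactor_bound (q : ℕ) [NeZero q] :
    ∃ ρ : ℝ, 0 < ρ ∧ ρ < 1 ∧ ∀ s : ZMod q, s ≠ 0 → ‖edgeFactor s‖ ≤ ρ := by
  classical
  have hne : (insert (1 / 2 : ℝ)
      (({s | s ≠ 0} : Finset (ZMod q)).image fun s => ‖edgeFactor s‖)).Nonempty :=
    Finset.insert_nonempty _ _
  refine ⟨Finset.max' _ hne, ?_, ?_, ?_⟩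
  · exact lt_of_lt_of_le (by norm_num) (Finset.le_max' _ (1 / 2 : ℝ) (Finset.mem_insert_self _ _))
  · rw [Finset.max'_lt_iff]
    intro y hy
    rw [Finset.mem_insert, Finset.mem_image] at hy
    rcases hy with rfl | ⟨s, hs, rfl⟩
    · norm_num
    · exact norm_edgeFactor_lt_one (by simpa using hs)
  · intro s hs
    apply Finset.le_max'
    exact Finset.mem_insert_of_mem (Finset.mem_image_of_mem _ (by simpa using hs))

end Factor

/-! ### Vertex types and bad vertices -/

section Types

variable {V J : Type*} [Fintype V] [LinearOrder V] [Fintype J] [DecidableEq J]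
variable {q : ℕ} [NeZero q]

/-- The type of a vertex: the indices `j` with `v ∈ A j`, and the frequencies at `v`. -/
def vertexType (A : J → Finset V) (x : V × J → ZMod q) (v : V) : Finset J × (J → ZMod q) :=
  (Finset.univ.filter fun j => v ∈ A j, fun j => x (v, j))

/-- The weight of a pair of vertices in terms of their types. -/
def typeWeight (σ τ : Finset J × (J → ZMod q)) : ZMod q :=
  ∑ j, if j ∈ σ.1 ∧ j ∈ τ.1 then σ.2 j + τ.2 j else 0

omit [Fintype V] [NeZero q] in
lemma typeWeight_vertexType (A : J → Finset V) (x : V × J → ZMod q) (u v : V) :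
    typeWeight (vertexType A x u) (vertexType A x v) = pairWeight A x u v := by
  simp [typeWeight, vertexType, pairWeight]

/-- The types that occur at least `L` times. -/
noncomputable def largeTypes (L : ℝ) (A : J → Finset V) (x : V × J → ZMod q) :
    Finset (Finset J × (J → ZMod q)) :=
  {τ | L ≤ #{v | vertexType A x v = τ}}

/-- The vertices whose type has nonzero weight with some large type. -/
noncomputable def badVertices (L : ℝ) (A : J → Finset V) (x : V × J → ZMod q) : Finset V :=
  {v | ∃ τ ∈ largeTypes L A x, typeWeight (vertexType A x v) τ ≠ 0}

/-- A bad vertex has nonzero weight with at least `L - 1` other vertices (its own type may be the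
large one), so by the handshake lemma at least `#bad * (L - 1) / 2` factors have norm at most `ρ`.
-/
lemma norm_prod_edgeFactor_le {ρ : ℝ} (h0 : 0 < ρ) (h1 : ρ ≤ 1)
    (hρ : ∀ s : ZMod q, s ≠ 0 → ‖edgeFactor s‖ ≤ ρ) (L : ℝ)
    (A : J → Finset V) (x : V × J → ZMod q) :
    ‖∏ e : Sym2 V with ¬ e.IsDiag, edgeFactor (edgeWeight A x e)‖ ≤
      (ρ ^ ((L - 1) / 2)) ^ #(badVertices L A x) := by
  classical
  let H : SimpleGraph V :=
    { Adj := fun u v => u ≠ v ∧ pairWeight A x u v ≠ 0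
      symm := ⟨fun u v h => ⟨h.1.symm, by rw [pairWeight_comm]; exact h.2⟩⟩
      loopless := ⟨fun u h => h.1 rfl⟩ }
  have hE : ‖∏ e : Sym2 V with ¬ e.IsDiag, edgeFactor (edgeWeight A x e)‖ ≤ ρ ^ #H.edgeFinset := by
    rw [norm_prod]
    calc ∏ e : Sym2 V with ¬ e.IsDiag, ‖edgeFactor (edgeWeight A x e)‖
        ≤ ∏ e : Sym2 V with ¬ e.IsDiag, (if e ∈ H.edgeFinset then ρ else 1) := by
          refine Finset.prod_le_prod (fun _ _ => norm_nonneg _) fun e _ => ?_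
          split_ifs with he
          · apply hρ
            induction e with
            | _ u v => 
              rw [SimpleGraph.mem_edgeFinset, SimpleGraph.mem_edgeSet] at he
              exact he.2
          · exact norm_edgeFactor_le_one _
      _ = ρ ^ #H.edgeFinset := by
          rw [← Finset.prod_filter, Finset.prod_const]
          congr 2
          ext e
          simp only [Finset.mem_filter, Finset.mem_univ, true_and]
          exact ⟨fun h => h.2, fun h => ⟨H.not_isDiag_of_mem_edgeFinset h, h⟩⟩
  have hdeg : ∀ v ∈ badVertices L A x, L - 1 ≤ H.degree v := by
    intro v hv
    simp only [badVertices, Finset.mem_filter, Finset.mem_univ, true_and, largeTypes] at hv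
    obtain ⟨τ, hτ, hw⟩ := hv
    have hsub : ({u | vertexType A x u = τ} : Finset V) ⊆ insert v (H.neighborFinset v) := by
      intro u hu
      simp only [Finset.mem_filter, Finset.mem_univ, true_and] at hu
      rw [Finset.mem_insert, SimpleGraph.mem_neighborFinset]
      by_cases huv : u = v
      · exact Or.inl huv
      · refine Or.inr ⟨Ne.symm huv, ?_⟩
        rw [← typeWeight_vertexType, hu]
        exact hw
    have h2 := (Finset.card_le_card hsub).trans (Finset.card_insert_le _ _)
    rw [SimpleGraph.card_neighborFinset_eq_degree] at h2
    have h3 : ((#{u | vertexType A x u = τ} : ℕ) : ℝ) ≤ H.degree v + 1 := by exact_mod_cast h2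
    linarith
  have hsum : #(badVertices L A x) * (L - 1) ≤ 2 * (#H.edgeFinset : ℝ) := by
    calc #(badVertices L A x) * (L - 1) ≤ ∑ v ∈ badVertices L A x, (H.degree v : ℝ) := by
          rw [← nsmul_eq_mul]
          exact Finset.card_nsmul_le_sum _ _ _ hdeg
      _ ≤ ∑ v, (H.degree v : ℝ) :=
          Finset.sum_le_sum_of_subset_of_nonneg (Finset.subset_univ _) (fun _ _ _ => by positivity)
      _ = 2 * (#H.edgeFinset : ℝ) := by exact_mod_cast H.sum_degrees_eq_twice_card_edges
  refine hE.trans ?_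
  rw [← Real.rpow_natCast, ← Real.rpow_natCast, ← Real.rpow_mul h0.le]
  exact Real.rpow_le_rpow_of_exponent_ge h0 h1 (by linarith)

/-- The vertices `u ∈ A j` for which `j` is the only index `i` with both `u` and `v` in `A i`. -/
def privateNeighbors (A : J → Finset V) (v : V) (j : J) : Finset V :=
  {u ∈ A j | ∀ i, i ≠ j → ¬ (v ∈ A i ∧ u ∈ A i)}

omit [Fintype V] [NeZero q] in
lemma typeWeight_of_mem_privateNeighbors {A : J → Finset V} (x y : V × J → ZMod q) {u v : V}
    {j : J} (hv : v ∈ A j) (hu : u ∈ privateNeighbors A v j) :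
    typeWeight (vertexType A x v) (vertexType A y u) = x (v, j) + y (u, j) := by
  simp only [privateNeighbors, Finset.mem_filter] at hu
  simp only [typeWeight, vertexType, Finset.mem_filter, Finset.mem_univ, true_and]
  rw [Finset.sum_eq_single j]
  · simp [hv, hu.1]
  · intro i _ hi
    rw [if_neg (hu.2 i hi)]
  · simp

variable (q J) in
/-- The number of possible vertex types. -/
def numTypes : ℕ := Fintype.card (Finset J × (J → ZMod q))

/-- Pigeonhole: a set of at least `numTypes * L` vertices contains a vertex of a large type. -/
lemma exists_large_type {L : ℝ} (hL : 0 < L) (A : J → Finset V) (x : V × J → ZMod q) {S : Finset V}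
    (hS : numTypes J q * L ≤ #S) : ∃ u ∈ S, vertexType A x u ∈ largeTypes L A x := by
  classical
  by_contra! h
  have h1 : (#S : ℝ) = ∑ τ : Finset J × (J → ZMod q), (#{u ∈ S | vertexType A x u = τ} : ℝ) := by
    exact_mod_cast Finset.card_eq_sum_card_fiberwise
      (fun _ _ => Finset.mem_coe.2 (Finset.mem_univ _))
  have h2 : (#S : ℝ) < ∑ τ : Finset J × (J → ZMod q), L := by
    rw [h1]
    refine Finset.sum_lt_sum_of_nonempty Finset.univ_nonempty fun τ _ => ?_
    by_cases hτ : τ ∈ largeTypes L A x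
    · have : ({u ∈ S | vertexType A x u = τ} : Finset V) = ∅ := by
        rw [Finset.filter_eq_empty_iff]
        rintro u hu rfl
        exact h u hu hτ
      rw [this]; simpa using hL
    · simp only [largeTypes, Finset.mem_filter, Finset.mem_univ, true_and, not_le] at hτ
      refine lt_of_le_of_lt ?_ hτ
      exact_mod_cast Finset.card_le_card (Finset.filter_subset_filter _ (Finset.subset_univ _))
  rw [Finset.sum_const, Finset.card_univ, nsmul_eq_mul] at h2
  exact absurd hS (not_le.2 h2)

/-- If all `privateNeighbors` are numerous, then the frequencies are determined by the set of large
types, the set of bad vertices and the frequencies at the bad vertices: a vertex `v ∈ A j` that is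
not bad has some `u` of a large type among its private neighbours, and then
`x (v, j) = -x (u, j)`. -/
lemma eq_of_same_large_bad {L : ℝ} (hL : 0 < L) {A : J → Finset V}
    (hA : ∀ j, ∀ v ∈ A j, numTypes J q * L ≤ #(privateNeighbors A v j))
    {x y : V × J → ZMod q} (hx : x ∈ supportedVectors q A) (hy : y ∈ supportedVectors q A)
    (hl : largeTypes L A x = largeTypes L A y) (hb : badVertices L A x = badVertices L A y)
    (hxy : ∀ v ∈ badVertices L A x, ∀ j, x (v, j) = y (v, j)) : x = y := by
  ext ⟨v, j⟩
  by_cases hv : v ∈ badVertices L A x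
  · exact hxy v hv j
  by_cases hj : v ∈ A j
  swap
  · rw [mem_supportedVectors.1 hx v j hj, mem_supportedVectors.1 hy v j hj]
  obtain ⟨u, hu, hul⟩ := exists_large_type hL A x (hA j v hj)
  have hv' : v ∉ badVertices L A y := hb ▸ hv
  simp only [badVertices, Finset.mem_filter, Finset.mem_univ, true_and, not_exists, not_and,
    not_not] at hv hv'
  have h1 := hv _ hul
  have h2 := hv' _ (hl ▸ hul)
  rw [typeWeight_of_mem_privateNeighbors x x hj hu] at h1
  rw [typeWeight_of_mem_privateNeighbors y x hj hu] at h2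
  exact add_right_cancel (h1.trans h2.symm)

lemma sum_badVertices_le {L : ℝ} (hL : 0 < L) {A : J → Finset V}
    (hA : ∀ j, ∀ v ∈ A j, numTypes J q * L ≤ #(privateNeighbors A v j))
    (g : Finset V → ℝ) (hg : ∀ B, 0 ≤ g B) :
    ∑ x ∈ supportedVectors q A, g (badVertices L A x) ≤
      2 ^ numTypes J q * ∑ B : Finset V, g B * ((q : ℝ) ^ Fintype.card J) ^ #B := by
  classical
  have hfib : ∀ (B : Finset V) (T : Finset (Finset J × (J → ZMod q))),
      #{x ∈ supportedVectors q A | (badVertices L A x, largeTypes L A x) = (B, T)} ≤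
        (q ^ Fintype.card J) ^ #B := by
    intro B T
    have : Fintype.card (B × J → ZMod q) = (q ^ Fintype.card J) ^ #B := by
      rw [Fintype.card_fun, Fintype.card_prod, ZMod.card, Fintype.card_coe, mul_comm, pow_mul]
    rw [← this, ← Finset.card_univ]
    refine Finset.card_le_card_of_injOn (fun x p => x (p.1, p.2))
      (fun _ _ => Finset.mem_coe.2 (Finset.mem_univ _)) ?_
    intro x hx y hy hxy
    simp only [Finset.coe_filter, Set.mem_ofPred_eq, Prod.mk.injEq] at hx hy
    refine eq_of_same_large_bad hL hA hx.1 hy.1 (hx.2.2.trans hy.2.2.symm)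
      (hx.2.1.trans hy.2.1.symm) fun v hv j => ?_
    exact congrFun hxy (⟨v, hx.2.1 ▸ hv⟩, j)
  rw [← Finset.sum_fiberwise_of_maps_to (t := Finset.univ)
    (g := fun x => (badVertices L A x, largeTypes L A x)) (fun _ _ => Finset.mem_univ _)]
  calc _ ≤ ∑ p : Finset V × Finset (Finset J × (J → ZMod q)),
        g p.1 * ((q : ℝ) ^ Fintype.card J) ^ #p.1 := by
        refine Finset.sum_le_sum fun p _ => ?_
        rw [Finset.sum_congr rfl (g := fun _ => g p.1) (fun x hx => by
          rw [Finset.mem_filter] at hx; rw [← hx.2]), Finset.sum_const, nsmul_eq_mul, mul_comm]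
        refine mul_le_mul_of_nonneg_left ?_ (hg _)
        exact_mod_cast hfib p.1 p.2
    _ = _ := by
        rw [Fintype.sum_prod_type]
        simp only [Finset.sum_const, Finset.card_univ, nsmul_eq_mul, ← Finset.mul_sum]
        rw [Fintype.card_finset]
        simp [numTypes]

omit [LinearOrder V] in
lemma sum_pow_card_eq (a : ℝ) : ∑ B : Finset V, a ^ #B = (1 + a) ^ Fintype.card V := by
  have := Finset.sum_pow_mul_eq_add_pow a 1 (Finset.univ : Finset V)
  simpa [add_comm] using this

theorem graphProb_mul_pow_le {ρ : ℝ} (h0 : 0 < ρ) (h1 : ρ ≤ 1)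
    (hρ : ∀ s : ZMod q, s ≠ 0 → ‖edgeFactor s‖ ≤ ρ) (r : ℕ) {L : ℝ} (hL : 0 < L)
    {A : J → Finset V}
    (hA : ∀ j, ∀ v ∈ A j, numTypes J q * L ≤ #(privateNeighbors A v j)) :
    graphProb (fun G => FamilyDegreesMod G q r A) * (q : ℝ) ^ (∑ j, #(A j)) ≤
      2 ^ numTypes J q *
        (1 + ρ ^ ((L - 1) / 2) * (q : ℝ) ^ Fintype.card J) ^ Fintype.card V := by
  have hκ : 0 ≤ ρ ^ ((L - 1) / 2) := by positivity
  calc _ ≤ ‖((graphProb (fun G => FamilyDegreesMod G q r A) *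
          (q : ℝ) ^ (∑ j, #(A j)) : ℝ) : ℂ)‖ := by
        rw [Complex.norm_real]; exact le_abs_self _
    _ ≤ ∑ x ∈ supportedVectors q A, (ρ ^ ((L - 1) / 2)) ^ #(badVertices L A x) := by
        rw [graphProb_mul_pow]
        refine (norm_sum_le _ _).trans (Finset.sum_le_sum fun x _ => ?_)
        rw [norm_mul, AddChar.norm_apply, one_mul]
        exact norm_prod_edgeFactor_le h0 h1 hρ L A x
    _ ≤ _ := by
        refine (sum_badVertices_le hL hA (fun B => (ρ ^ ((L - 1) / 2)) ^ #B)
          fun B => by positivity).trans_eq ?_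
        simp only [← mul_pow]
        rw [sum_pow_card_eq]

/-- The two-torsion of `ZMod q`. -/
def twoTorsion (q : ℕ) [NeZero q] : Finset (ZMod q) := {a | a + a = 0}

lemma one_le_card_twoTorsion : 1 ≤ #(twoTorsion q) :=
  Finset.card_pos.2 ⟨0, by simp [twoTorsion]⟩

/-- The vector of frequencies that equals `α j` on `A j`. -/
def partwiseVector (A : J → Finset V) (α : J → ZMod q) : V × J → ZMod q :=
  fun p => if p.1 ∈ A p.2 then α p.2 else 0

lemma badVertices_partwiseVector {L : ℝ} (hL : 0 < L) (A : J → Finset V) {α : J → ZMod q}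
    (hα : ∀ j, α j + α j = 0) : badVertices L A (partwiseVector A α) = ∅ := by
  rw [badVertices, Finset.filter_eq_empty_iff]
  rintro v - ⟨τ, hτ, hw⟩
  simp only [largeTypes, Finset.mem_filter, Finset.mem_univ, true_and] at hτ
  have : ({u | vertexType A (partwiseVector A α) u = τ} : Finset V).Nonempty := by
    rw [← Finset.card_pos]
    exact_mod_cast hL.trans_le hτ
  obtain ⟨u, hu⟩ := this
  rw [Finset.mem_filter] at hu
  apply hw
  rw [← hu.2, typeWeight_vertexType, pairWeight]
  refine Finset.sum_eq_zero fun j _ => ?_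
  split_ifs with h
  · simp [partwiseVector, h.1, h.2, hα]
  · rfl

omit [Fintype V] [DecidableEq J] [NeZero q] in
lemma edgeWeight_partwiseVector (A : J → Finset V) {α : J → ZMod q}
    (hα : ∀ j, α j + α j = 0) (e : Sym2 V) : edgeWeight A (partwiseVector A α) e = 0 := by
  induction e with
  | _ u v =>
    change pairWeight _ _ _ _ = _
    refine Finset.sum_eq_zero fun j _ => ?_
    split_ifs with h
    · simp [partwiseVector, h.1, h.2, hα]
    · rfl

/-- If any two vertices of `A j` have many private neighbours in common, then without bad vertices
the frequencies are constant on each `A j`, with a value in the two-torsion. -/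
lemma exists_partwiseVector {L : ℝ} (hL : 0 < L) {A : J → Finset V}
    (hA : ∀ j, ∀ v ∈ A j, ∀ w ∈ A j,
      numTypes J q * L ≤ #(privateNeighbors A v j ∩ privateNeighbors A w j))
    {x : V × J → ZMod q} (hx : x ∈ supportedVectors q A) (hb : badVertices L A x = ∅) :
    ∃ α : J → ZMod q, (∀ j, α j + α j = 0) ∧ partwiseVector A α = x := by
  classical
  have hgood : ∀ v, ∀ τ ∈ largeTypes L A x, typeWeight (vertexType A x v) τ = 0 := by
    intro v τ hτ
    by_contra h
    have : v ∈ badVertices L A x := by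
      simp only [badVertices, Finset.mem_filter, Finset.mem_univ, true_and]
      exact ⟨τ, hτ, h⟩
    simp [hb] at this
  have key : ∀ j, ∀ v ∈ A j, ∀ w ∈ A j, ∃ u ∈ A j,
      x (v, j) + x (u, j) = 0 ∧ x (w, j) + x (u, j) = 0 := by
    intro j v hv w hw
    obtain ⟨u, hu, hl⟩ := exists_large_type hL A x (hA j v hv w hw)
    rw [Finset.mem_inter] at hu
    refine ⟨u, (Finset.mem_filter.1 hu.1).1, ?_, ?_⟩
    · rw [← typeWeight_of_mem_privateNeighbors x x hv hu.1]; exact hgood v _ hl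
    · rw [← typeWeight_of_mem_privateNeighbors x x hw hu.2]; exact hgood w _ hl
  have heq : ∀ j, ∀ v ∈ A j, ∀ w ∈ A j, x (v, j) = x (w, j) := by
    intro j v hv w hw
    obtain ⟨u, -, h1, h2⟩ := key j v hv w hw
    exact add_right_cancel (h1.trans h2.symm)
  have htor : ∀ j, ∀ v ∈ A j, x (v, j) + x (v, j) = 0 := by
    intro j v hv
    obtain ⟨u, hu, h1, -⟩ := key j v hv v hv
    rwa [← heq j v hv u hu] at h1
  refine ⟨fun j => if h : (A j).Nonempty then x (h.choose, j) else 0, ?_, ?_⟩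
  · intro j
    by_cases h : (A j).Nonempty
    · simp only [h, dif_pos]; exact htor j _ h.choose_spec
    · simp [h]
  · ext ⟨v, j⟩
    by_cases hv : v ∈ A j
    · have h : (A j).Nonempty := ⟨v, hv⟩
      simp only [partwiseVector, hv, if_true, h, dif_pos]
      exact heq j _ h.choose_spec v hv
    · simp [partwiseVector, hv, mem_supportedVectors.1 hx v j hv]

theorem abs_graphProb_mul_pow_sub_le {ρ : ℝ} (h0 : 0 < ρ) (h1 : ρ ≤ 1)
    (hρ : ∀ s : ZMod q, s ≠ 0 → ‖edgeFactor s‖ ≤ ρ) (r : ℕ) {L : ℝ} (hL : 0 < L)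
    {A : J → Finset V} (hne : ∀ j, (A j).Nonempty)
    (hpar : ∀ j, ∀ a : ZMod q, a + a = 0 → (r : ZMod q) * (#(A j) * a) = 0)
    (hA : ∀ j, ∀ v ∈ A j, ∀ w ∈ A j,
      numTypes J q * L ≤ #(privateNeighbors A v j ∩ privateNeighbors A w j)) :
    |graphProb (fun G => FamilyDegreesMod G q r A) * (q : ℝ) ^ (∑ j, #(A j)) -
        (#(twoTorsion q) : ℝ) ^ Fintype.card J| ≤
      2 ^ numTypes J q *
        ((1 + ρ ^ ((L - 1) / 2) * (q : ℝ) ^ Fintype.card J) ^ Fintype.card V - 1) := by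
  classical
  have hA' : ∀ j, ∀ v ∈ A j, numTypes J q * L ≤ #(privateNeighbors A v j) := by
    intro j v hv
    simpa using hA j v hv v hv
  set T : (V × J → ZMod q) → ℂ := fun x => ZMod.stdAddChar (-(r : ZMod q) * ∑ p, x p) *
        ∏ e : Sym2 V with ¬ e.IsDiag, edgeFactor (edgeWeight A x e) with hT
  have hmain : ∑ x ∈ supportedVectors q A with badVertices L A x = ∅, T x =
      ((#(twoTorsion q) : ℝ) ^ Fintype.card J : ℝ) := by
    have : ∑ α ∈ Fintype.piFinset (fun _ : J => twoTorsion q), (1 : ℂ) =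
        ((#(twoTorsion q) : ℝ) ^ Fintype.card J : ℝ) := by
      simp [Fintype.card_piFinset]
    rw [← this]
    symm
    refine Finset.sum_bij (fun α _ => partwiseVector A α) ?_ ?_ ?_ ?_
    · intro α hα
      simp only [Fintype.mem_piFinset, twoTorsion, Finset.mem_filter, Finset.mem_univ,
        true_and] at hα
      rw [Finset.mem_filter, mem_supportedVectors]
      exact ⟨fun v j hv => by simp [partwiseVector, hv], badVertices_partwiseVector hL A hα⟩
    · intro α _ β _ h
      ext j
      obtain ⟨v, hv⟩ := hne j
      have := congrFun h (v, j)
      simpa [partwiseVector, hv] using this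
    · intro x hx
      rw [Finset.mem_filter] at hx
      obtain ⟨α, hα, hαx⟩ := exists_partwiseVector hL hA hx.1 hx.2
      exact ⟨α, by simpa [Fintype.mem_piFinset, twoTorsion] using hα, hαx⟩
    · intro α hα
      simp only [Fintype.mem_piFinset, twoTorsion, Finset.mem_filter, Finset.mem_univ,
        true_and] at hα
      simp only [hT, edgeWeight_partwiseVector A hα, edgeFactor_zero, Finset.prod_const_one,
        mul_one]
      rw [Fintype.sum_prod_type_right, neg_mul, Finset.mul_sum, Finset.sum_eq_zero]
      · simp
      · intro j _
        rw [← hpar j (α j) (hα j)]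
        simp [partwiseVector]
  have hdiff : ((graphProb (fun G => FamilyDegreesMod G q r A) * (q : ℝ) ^ (∑ j, #(A j)) -
        (#(twoTorsion q) : ℝ) ^ Fintype.card J : ℝ) : ℂ) =
      ∑ x ∈ supportedVectors q A with ¬ badVertices L A x = ∅, T x := by
    rw [Complex.ofReal_sub, graphProb_mul_pow, ← hmain, sub_eq_iff_eq_add', 
      Finset.sum_filter_add_sum_filter_not]
  rw [← Real.norm_eq_abs, ← Complex.norm_real, hdiff]
  calc _ ≤ ∑ x ∈ supportedVectors q A with ¬ badVertices L A x = ∅,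
        (ρ ^ ((L - 1) / 2)) ^ #(badVertices L A x) := by
        refine (norm_sum_le _ _).trans (Finset.sum_le_sum fun x _ => ?_)
        rw [norm_mul, AddChar.norm_apply, one_mul]
        exact norm_prod_edgeFactor_le h0 h1 hρ L A x
    _ = ∑ x ∈ supportedVectors q A, (fun B : Finset V => if B = ∅ then 0 else
          (ρ ^ ((L - 1) / 2)) ^ #B) (badVertices L A x) := by
        rw [Finset.sum_filter]
        refine Finset.sum_congr rfl fun x _ => ?_
        by_cases h : badVertices L A x = ∅ <;> simp [h]
    _ ≤ _ := by
        refine (sum_badVertices_le hL hA' (fun B : Finset V => if B = ∅ then 0 else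
          (ρ ^ ((L - 1) / 2)) ^ #B) fun B => ?_).trans_eq ?_
        · split_ifs <;> positivity
        · congr 1
          rw [← sum_pow_card_eq, eq_sub_iff_add_eq, ← Finset.sum_erase_add _ _ (Finset.mem_univ ∅),
            ← Finset.sum_erase_add _ _ (Finset.mem_univ ∅)]
          simp only [if_true, zero_mul, add_zero, Finset.card_empty, pow_zero]
          congr 1
          refine Finset.sum_congr rfl fun B hB => ?_
          rw [if_neg (Finset.ne_of_mem_erase hB), mul_pow]

end Types

/-! ### Uniform asymptotics of the probability -/

section Asymptotics

lemma tendsto_one_add_rpow_pow {ρ : ℝ} (h0 : 0 < ρ) (h1 : ρ < 1) {c : ℝ} (hc : 0 < c) {Q : ℝ}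
    (hQ : 0 ≤ Q) :
    Tendsto (fun n : ℕ => (1 + ρ ^ ((c * n - 1) / 2) * Q) ^ n) atTop (𝓝 1) := by
  have h2 : Tendsto (fun n : ℕ => Real.exp
      (Q * ρ ^ (-(1 / 2) : ℝ) * (n * (ρ ^ (c / 2)) ^ n))) atTop (𝓝 1) := by
    have h3 : Tendsto (fun n : ℕ => (n : ℝ) * (ρ ^ (c / 2)) ^ n) atTop (𝓝 0) :=
      tendsto_self_mul_const_pow_of_lt_one (by positivity)
        (Real.rpow_lt_one h0.le h1 (by positivity))
    have h4 := (Real.continuous_exp.tendsto _).comp (h3.const_mul (Q * ρ ^ (-(1 / 2) : ℝ)))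
    simpa [Function.comp_def] using h4
  refine tendsto_of_tendsto_of_tendsto_of_le_of_le tendsto_const_nhds h2 ?_ ?_
  · intro n
    exact one_le_pow₀ (le_add_of_nonneg_right (by positivity))
  · intro n
    have h5 : ρ ^ ((c * n - 1) / 2) = ρ ^ (-(1 / 2) : ℝ) * (ρ ^ (c / 2)) ^ n := by
      rw [← Real.rpow_natCast, ← Real.rpow_mul h0.le, ← Real.rpow_add h0]
      congr 1; ring
    dsimp only
    calc (1 + ρ ^ ((c * n - 1) / 2) * Q) ^ n ≤ (Real.exp (ρ ^ ((c * n - 1) / 2) * Q)) ^ n := by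
          gcongr
          rw [add_comm]; exact Real.add_one_le_exp _
      _ = _ := by
          rw [← Real.exp_nat_mul, h5]; congr 1; ring

variable {J : Type*} [Fintype J] [DecidableEq J] (q : ℕ) [NeZero q]

lemma numTypes_pos : 0 < (numTypes J q : ℝ) := by
  exact_mod_cast Fintype.card_pos

theorem exists_graphProb_mul_pow_le {ε : ℝ} (hε : 0 < ε) :
    ∃ C : ℝ, 0 < C ∧ ∀ᶠ n : ℕ in atTop, ∀ (r : ℕ) (A : J → Finset (Fin n)),
      (∀ j, ∀ v ∈ A j, ε * n ≤ #(privateNeighbors A v j)) →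
      graphProb (fun G => FamilyDegreesMod G q r A) * (q : ℝ) ^ (∑ j, #(A j)) ≤ C := by
  obtain ⟨ρ, h0, h1, hρ⟩ := exists_edgeFactor_bound q
  have hK := numTypes_pos (J := J) q
  have hc : 0 < ε / numTypes J q := by positivity
  refine ⟨2 ^ numTypes J q * 2, by positivity, ?_⟩
  have ht := tendsto_one_add_rpow_pow h0 h1 hc (Q := (q : ℝ) ^ Fintype.card J) (by positivity)
  filter_upwards [ht.eventually_le_const one_lt_two, eventually_gt_atTop 0] with n hn hn0 r A hA
  have hn0' : (0 : ℝ) < n := by exact_mod_cast hn0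
  refine (graphProb_mul_pow_le h0 h1.le hρ r (L := ε / numTypes J q * n) (by positivity)
    ?_).trans ?_
  · intro j v hv
    refine le_trans (le_of_eq ?_) (hA j v hv)
    field_simp
  · rw [Fintype.card_fin]
    gcongr

theorem eventually_abs_graphProb_mul_pow_sub_le {ε : ℝ} (hε : 0 < ε) {η : ℝ} (hη : 0 < η) :
    ∀ᶠ n : ℕ in atTop, ∀ (r : ℕ) (A : J → Finset (Fin n)), (∀ j, (A j).Nonempty) →
      (∀ j, ∀ a : ZMod q, a + a = 0 → (r : ZMod q) * (#(A j) * a) = 0) →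
      (∀ j, ∀ v ∈ A j, ∀ w ∈ A j,
        ε * n ≤ #(privateNeighbors A v j ∩ privateNeighbors A w j)) →
      |graphProb (fun G => FamilyDegreesMod G q r A) * (q : ℝ) ^ (∑ j, #(A j)) -
        (#(twoTorsion q) : ℝ) ^ Fintype.card J| ≤ η := by
  obtain ⟨ρ, h0, h1, hρ⟩ := exists_edgeFactor_bound q
  have hK := numTypes_pos (J := J) q
  have hc : 0 < ε / numTypes J q := by positivity
  have ht := tendsto_one_add_rpow_pow h0 h1 hc (Q := (q : ℝ) ^ Fintype.card J) (by positivity)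
  have ht2 := (ht.sub_const 1).const_mul ((2 : ℝ) ^ numTypes J q)
  rw [sub_self, mul_zero] at ht2
  filter_upwards [ht2.eventually_le_const hη, eventually_gt_atTop 0] with n hn hn0 r A hne hpar hA
  have hn0' : (0 : ℝ) < n := by exact_mod_cast hn0
  refine (abs_graphProb_mul_pow_sub_le h0 h1.le hρ r (L := ε / numTypes J q * n) (by positivity)
    hne hpar ?_).trans ?_
  · intro j v hv w hw
    refine le_trans (le_of_eq ?_) (hA j v hv w hw)
    field_simp
  · rw [Fintype.card_fin]
    exact hn

end Asymptotics

/-! ### Colourings with given class sizes, and small sets -/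

section Counting

lemma factorial_le_pow_mul_exp {m : ℕ} (hm : 1 ≤ m) :
    (m.factorial : ℝ) ≤ (m : ℝ) ^ (m + 1) * Real.exp (1 - m) := by
  induction m, hm using Nat.le_induction with
  | base => simp
  | succ m hm ih =>
    have hm' : (0 : ℝ) < m := by exact_mod_cast hm
    have h1 : (m : ℝ) ^ (m + 1) * Real.exp 1 ≤ (m + 1 : ℝ) ^ (m + 1) := by
      have h2 : (m : ℝ) / (m + 1) ≤ Real.exp (-(1 / (m + 1))) := by
        have := Real.add_one_le_exp (-(1 / ((m : ℝ) + 1)))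
        refine le_trans (le_of_eq ?_) this
        field_simp; ring
      have h3 : ((m : ℝ) / (m + 1)) ^ (m + 1) ≤ Real.exp (-1) := by
        refine (pow_le_pow_left₀ (by positivity) h2 _).trans_eq ?_
        rw [← Real.exp_nat_mul]; congr 1; push_cast; field_simp
      rw [div_pow, div_le_iff₀ (by positivity)] at h3
      calc _ ≤ Real.exp (-1) * (m + 1 : ℝ) ^ (m + 1) * Real.exp 1 := by gcongr
        _ = (Real.exp (-1) * Real.exp 1) * (m + 1 : ℝ) ^ (m + 1) := by ring
        _ = _ := by rw [← Real.exp_add]; simp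
    rw [Nat.factorial_succ]
    push_cast
    calc ((m : ℝ) + 1) * m.factorial ≤ (m + 1) * ((m : ℝ) ^ (m + 1) * Real.exp (1 - m)) := by gcongr
      _ = (m + 1) * ((m : ℝ) ^ (m + 1) * Real.exp 1) * Real.exp (1 - (m + 1)) := by
          rw [show (1 - m : ℝ) = 1 + (1 - (m + 1)) by ring, Real.exp_add]; ring
      _ ≤ (m + 1) * ((m + 1 : ℝ) ^ (m + 1)) * Real.exp (1 - (m + 1)) := by gcongr
      _ = _ := by ring

/-- There are at most `μ ^ n` sets of size at most `δ n`, if `δ` is small in terms of `μ > 1`. -/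
lemma exists_card_small_sets_le {μ : ℝ} (hμ : 1 < μ) :
    ∃ δ : ℝ, 0 < δ ∧ ∀ n : ℕ, (#{T : Finset (Fin n) | (#T : ℝ) ≤ δ * n} : ℝ) ≤ μ ^ n := by
  have hs : 1 < √μ := by rw [Real.lt_sqrt] <;> norm_num; exact hμ
  -- Weight each set `T` by `y ^ #T`: the total weight is `(1 + y) ^ n ≤ √μ ^ n`, and each small set
  -- has weight at least `y ^ (δ n) = √μ ^ (-n)`.
  set y : ℝ := min (√μ - 1) (1 / 2) with hy
  have hy0 : 0 < y := lt_min (by linarith) (by norm_num)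
  have hy1 : y < 1 := (min_le_right _ _).trans_lt (by norm_num)
  have hy2 : 1 + y ≤ √μ := by have := min_le_left (√μ - 1) (1 / 2); linarith
  have hly : Real.log y < 0 := Real.log_neg hy0 hy1
  have hls : 0 < Real.log √μ := Real.log_pos hs
  refine ⟨Real.log √μ / (-Real.log y), div_pos hls (by linarith), fun n => ?_⟩
  set δ := Real.log √μ / (-Real.log y)
  have hyδ : y ^ (-δ) = √μ := by
    rw [Real.rpow_def_of_pos hy0]
    have : Real.log y * -δ = Real.log √μ := by
      simp only [δ]; field_simp; exact div_self hly.ne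
    rw [this, Real.exp_log (by linarith)]
  calc (#{T : Finset (Fin n) | (#T : ℝ) ≤ δ * n} : ℝ)
      = ∑ T : Finset (Fin n) with (#T : ℝ) ≤ δ * n, (1 : ℝ) := by simp
    _ ≤ ∑ T : Finset (Fin n) with (#T : ℝ) ≤ δ * n, y ^ #T * (√μ) ^ n := by
        refine Finset.sum_le_sum fun T hT => ?_
        rw [Finset.mem_filter] at hT
        rw [← hyδ, ← Real.rpow_natCast, ← Real.rpow_natCast, ← Real.rpow_mul hy0.le,
          ← Real.rpow_add hy0]
        exact Real.one_le_rpow_of_pos_of_le_one_of_nonpos hy0 hy1.le (by linarith [hT.2])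
    _ ≤ ∑ T : Finset (Fin n), y ^ #T * (√μ) ^ n :=
        Finset.sum_le_sum_of_subset_of_nonneg (Finset.filter_subset _ _) fun _ _ _ => by positivity
    _ = (1 + y) ^ n * (√μ) ^ n := by
        rw [← Finset.sum_mul, sum_pow_card_eq, Fintype.card_fin]
    _ ≤ (√μ) ^ n * (√μ) ^ n := by gcongr
    _ = μ ^ n := by
        rw [← mul_pow, Real.mul_self_sqrt (by linarith)]

variable {V I : Type*} [Fintype V] [DecidableEq V] [Fintype I] [DecidableEq I]

/-- The class of the colour `i`. -/
def colorClass (χ : V → I) (i : I) : Finset V := {v | χ v = i}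

omit [DecidableEq V] [Fintype I] in
lemma mem_colorClass {χ : V → I} {i : I} {v : V} : v ∈ colorClass χ i ↔ χ v = i := by
  simp [colorClass]

/-- The colourings of `V` in which the class of each colour `i` has size `m i`. -/
def coloringsOfSizes (V : Type*) [Fintype V] [DecidableEq V] {I : Type*} [Fintype I]
    [DecidableEq I] (m : I → ℕ) : Finset (V → I) := {χ | ∀ i, #(colorClass χ i) = m i}

lemma mem_coloringsOfSizes {m : I → ℕ} {χ : V → I} :
    χ ∈ coloringsOfSizes V m ↔ ∀ i, #(colorClass χ i) = m i := by simp [coloringsOfSizes]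

lemma coloringsOfSizes_nonempty {m : I → ℕ} (hm : ∑ i, m i = Fintype.card V) :
    (coloringsOfSizes V m).Nonempty := by
  have e : V ≃ Σ i, Fin (m i) := Fintype.equivOfCardEq (by simp [hm])
  refine ⟨fun v => (e v).1, mem_coloringsOfSizes.2 fun i => ?_⟩
  have : Fintype.card (Fin (m i)) = m i := Fintype.card_fin _
  rw [← this, ← Finset.card_univ]
  symm
  refine Finset.card_bij (fun a _ => e.symm ⟨i, a⟩) ?_ ?_ ?_
  · intro a _
    simp [mem_colorClass]
  · intro a _ b _ h
    simpa using h
  · intro v hv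
    rw [mem_colorClass] at hv
    subst hv
    exact ⟨(e v).2, Finset.mem_univ _, by simp⟩

/-- One half of the multinomial formula: permuting a fixed colouring hits each colouring at most
`∏ i, (m i)!` times. -/
lemma factorial_le_card_coloringsOfSizes_mul {m : I → ℕ} (hm : ∑ i, m i = Fintype.card V) :
    (Fintype.card V).factorial ≤ #(coloringsOfSizes V m) * ∏ i, (m i).factorial := by
  obtain ⟨χ₀, h₀⟩ := coloringsOfSizes_nonempty (V := V) hm
  rw [mem_coloringsOfSizes] at h₀
  rw [← Fintype.card_perm, ← Finset.card_univ, mul_comm]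
  refine Finset.card_le_mul_card_image_of_maps_to (f := fun σ : Equiv.Perm V => χ₀ ∘ σ) ?_ _ ?_
  · intro σ _
    rw [mem_coloringsOfSizes]
    intro i
    rw [← h₀ i]
    exact Finset.card_bij (fun v _ => σ v) (fun v hv => by simpa [mem_colorClass] using hv)
      (fun _ _ _ _ h => σ.injective h)
      (fun v hv => ⟨σ.symm v, by simpa [mem_colorClass] using hv, by simp⟩)
  · intro χ _
    have hst : #{g : Equiv.Perm V | χ₀ ∘ g = χ₀} = ∏ i, (m i).factorial := by
      rw [← Fintype.card_subtype, DomMulAct.stabilizer_card]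
      refine Finset.prod_congr rfl fun i _ => ?_
      rw [← h₀ i, Fintype.card_subtype]; rfl
    rw [← hst]
    by_cases hne : ({σ | χ₀ ∘ σ = χ} : Finset (Equiv.Perm V)).Nonempty
    · obtain ⟨σ₀, hσ₀⟩ := hne
      simp only [Finset.mem_filter, Finset.mem_univ, true_and] at hσ₀
      refine Finset.card_le_card_of_injOn (fun σ => σ * σ₀⁻¹) ?_ ?_
      · intro σ hσ
        simp only [Finset.coe_filter, Finset.mem_univ, true_and, Set.mem_ofPred_eq] at hσ ⊢
        ext v
        have h1 := congrFun (hσ.trans hσ₀.symm) (σ₀⁻¹ v)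
        simpa using h1
      · intro a _ b _ h
        simpa using h
    · rw [Finset.not_nonempty_iff_eq_empty.1 hne]; simp

end Counting

/-! ### Counting pairs of colourings -/

section Counting

/-- The sizes `m i` of `t` classes add up to `n` and are within `2` of `n / t`. The slack covers the
rounding to even sizes. -/
structure IsNearlyEqual (t n : ℕ) (m : Fin t → ℕ) : Prop where
  sum_eq : ∑ i, m i = n
  abs_sub_le : ∀ i, |(m i : ℝ) - n / t| ≤ 2

lemma IsNearlyEqual.le_add {t n : ℕ} {m : Fin t → ℕ} (h : IsNearlyEqual t n m) (i : Fin t) :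
    (m i : ℝ) ≤ n / t + 2 := by
  have := (abs_le.1 (h.abs_sub_le i)).2; linarith

lemma IsNearlyEqual.sub_le {t n : ℕ} {m : Fin t → ℕ} (h : IsNearlyEqual t n m) (i : Fin t) :
    (n : ℝ) / t - 2 ≤ m i := by
  have := (abs_le.1 (h.abs_sub_le i)).1; linarith

lemma IsNearlyEqual.le {t n : ℕ} {m : Fin t → ℕ} (h : IsNearlyEqual t n m) (i : Fin t) :
    m i ≤ n := by
  rw [← h.sum_eq]
  exact Finset.single_le_sum (fun _ _ => Nat.zero_le _) (Finset.mem_univ i)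

/-- The number of colourings with nearly equal class sizes is `t ^ n` up to a polynomial factor. -/
lemma pow_le_card_coloringsOfSizes {t n : ℕ} (ht : 1 ≤ t) (hn : 3 * t ≤ n) {m : Fin t → ℕ}
    (hm : IsNearlyEqual t n m) :
    (t : ℝ) ^ n ≤ #(coloringsOfSizes (Fin n) m) * (Real.exp (3 * t) * (n : ℝ) ^ t) := by
  have ht' : (0 : ℝ) < t := by exact_mod_cast ht
  have hn' : 3 * (t : ℝ) ≤ n := by exact_mod_cast hn
  have hn0 : (0 : ℝ) < n := by linarith
  have hm1 : ∀ i, 1 ≤ m i := by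
    intro i
    have h1 := hm.sub_le i
    have h2 : (3 : ℝ) ≤ n / t := by rw [le_div_iff₀ ht']; exact hn'
    have h3 : (1 : ℝ) ≤ m i := by linarith
    exact_mod_cast h3
  have hfac := factorial_le_card_coloringsOfSizes_mul (V := Fin n) (m := m)
    (by rw [hm.sum_eq, Fintype.card_fin])
  rw [Fintype.card_fin] at hfac
  have hfac' : (n.factorial : ℝ) ≤ #(coloringsOfSizes (Fin n) m) * ∏ i, ((m i).factorial : ℝ) := by
    exact_mod_cast hfac
  set N : ℝ := ((#(coloringsOfSizes (Fin n) m) : ℕ) : ℝ)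
  have hprod : ∏ i, ((m i).factorial : ℝ) ≤
      (n / t + 2 : ℝ) ^ n * (n : ℝ) ^ t * Real.exp (t - n) := by
    calc ∏ i, ((m i).factorial : ℝ)
        ≤ ∏ i, ((n / t + 2 : ℝ) ^ m i * n * Real.exp (1 - m i)) := by
          refine Finset.prod_le_prod (fun _ _ => by positivity) fun i _ => ?_
          refine (factorial_le_pow_mul_exp (hm1 i)).trans ?_
          rw [pow_succ]
          have h4 : (m i : ℝ) ≤ n := by exact_mod_cast hm.le i
          have h5 := hm.le_add i
          gcongr
      _ = _ := by
          rw [Finset.prod_mul_distrib, Finset.prod_mul_distrib, Finset.prod_pow_eq_pow_sum,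
            hm.sum_eq, ← Real.exp_sum]
          simp only [Finset.prod_const, Finset.card_univ, Fintype.card_fin, Finset.sum_sub_distrib,
            Finset.sum_const, nsmul_eq_mul, mul_one]
          congr 3
          exact_mod_cast hm.sum_eq
  have hn1 : (n : ℝ) ^ n ≤ n.factorial * Real.exp n := by
    have := Real.pow_div_factorial_le_exp (n : ℝ) hn0.le n
    rw [div_le_iff₀ (by positivity)] at this
    linarith
  have h6 : (n / t + 2 : ℝ) ^ n * t ^ n ≤ n ^ n * Real.exp (2 * t) := by
    have : (n / t + 2 : ℝ) * t ≤ n * Real.exp (2 * t / n) := by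
      have h7 := Real.add_one_le_exp (2 * (t : ℝ) / n)
      calc (n / t + 2 : ℝ) * t = n * (2 * t / n + 1) := by field_simp; ring
        _ ≤ _ := by gcongr
    calc (n / t + 2 : ℝ) ^ n * t ^ n = ((n / t + 2 : ℝ) * t) ^ n := by rw [mul_pow]
      _ ≤ (n * Real.exp (2 * t / n)) ^ n := by gcongr
      _ = _ := by
        rw [mul_pow, ← Real.exp_nat_mul]
        congr 2; field_simp
  have hpos : 0 < (n : ℝ) ^ n := by positivity
  have hN : 0 ≤ N := Nat.cast_nonneg _
  refine le_of_mul_le_mul_left ?_ hpos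
  calc (n : ℝ) ^ n * t ^ n ≤ (N * ((n / t + 2 : ℝ) ^ n * (n : ℝ) ^ t * Real.exp (t - n))) *
        Real.exp n * t ^ n := by
        gcongr
        refine hn1.trans ?_
        gcongr
        exact hfac'.trans (by gcongr)
    _ = N * (n : ℝ) ^ t * ((n / t + 2 : ℝ) ^ n * t ^ n) * (Real.exp (t - n) * Real.exp n) := by ring
    _ = N * (n : ℝ) ^ t * ((n / t + 2 : ℝ) ^ n * t ^ n) * Real.exp t := by
        rw [← Real.exp_add]; simp
    _ ≤ N * (n : ℝ) ^ t * (n ^ n * Real.exp (2 * t)) * Real.exp t := by gcongr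
    _ = (n : ℝ) ^ n * (N * (Real.exp (2 * t + t) * n ^ t)) := by rw [Real.exp_add]; ring
    _ = _ := by congr 4; ring

/-- The number of colourings with nearly equal class sizes outgrows `b ^ n` for each `b < t`. -/
lemma eventually_mul_pow_le_card {t : ℕ} (ht : 1 ≤ t) {b : ℝ} (hb0 : 0 ≤ b) (hb : b < t) {C : ℝ}
    {η : ℝ} (hη : 0 < η) :
    ∀ᶠ n : ℕ in atTop, ∀ m : Fin t → ℕ, IsNearlyEqual t n m →
      C * b ^ n ≤ η * #(coloringsOfSizes (Fin n) m) := by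
  have ht' : (0 : ℝ) < t := by exact_mod_cast ht
  have h1 := (tendsto_pow_const_mul_const_pow_of_lt_one t (r := b / t) (by positivity)
    (by rw [div_lt_one ht']; exact hb)).const_mul (C * Real.exp (3 * t))
  rw [mul_zero] at h1
  filter_upwards [h1.eventually_le_const hη, eventually_ge_atTop (3 * t), eventually_gt_atTop 0]
    with n hn hn3 hn0 m hm
  have h2 := pow_le_card_coloringsOfSizes ht hn3 hm
  have hn0' : (0 : ℝ) < n := by exact_mod_cast hn0
  set N : ℝ := ((#(coloringsOfSizes (Fin n) m) : ℕ) : ℝ)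
  rw [div_pow, ← mul_div_assoc, ← mul_div_assoc, div_le_iff₀ (by positivity)] at hn
  have hX : 0 < Real.exp (3 * t) * (n : ℝ) ^ t := by positivity
  refine le_of_mul_le_mul_right ?_ hX
  calc C * b ^ n * (Real.exp (3 * t) * (n : ℝ) ^ t)
      = C * Real.exp (3 * t) * (n ^ t * b ^ n) := by ring
    _ ≤ η * t ^ n := hn
    _ ≤ η * (N * (Real.exp (3 * t) * (n : ℝ) ^ t)) := by gcongr
    _ = _ := by ring

variable {V I : Type*} [Fintype V] [DecidableEq V] [Fintype I] [DecidableEq I]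

/-- If the part of the class `j` inside `P` is prescribed, then `q` colours are left at most for
each vertex of `P`. -/
lemma card_colorings_cell_le (q : ℕ) (hq : 1 ≤ q) (hI : Fintype.card I = q + 1) (P : Finset V)
    (j : I) (T : Finset V) :
    #{χ : V → I | P ∩ colorClass χ j = T} ≤ q ^ #P * (q + 1) ^ (Fintype.card V - #P) := by
  classical
  have hsub : ({χ : V → I | P ∩ colorClass χ j = T} : Finset (V → I)) ⊆
      Fintype.piFinset (fun v => if v ∈ P then (if v ∈ T then {j} else Finset.univ.erase j)
        else Finset.univ) := by
    intro χ hχ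
    simp only [Finset.mem_filter, Finset.mem_univ, true_and] at hχ
    subst hχ
    rw [Fintype.mem_piFinset]
    intro v
    by_cases hv : v ∈ P <;> by_cases hj : χ v = j <;> simp [hv, hj, mem_colorClass]
  refine (Finset.card_le_card hsub).trans ?_
  rw [Fintype.card_piFinset]
  calc _ ≤ ∏ v : V, (if v ∈ P then q else q + 1) := by
        refine Finset.prod_le_prod' fun v _ => ?_
        split_ifs <;> simp [hI, hq]
    _ = _ := by
        rw [Finset.prod_ite]
        simp [Finset.filter_not, ← Finset.compl_eq_univ_sdiff, Finset.card_compl]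

/-- Every class of `χ` meets every class of `χ'` in at least `δ n` vertices. -/
def CrossWell (δ : ℝ) {n : ℕ} (χ χ' : Fin n → I) : Prop :=
  ∀ i j, δ * n ≤ #(colorClass χ i ∩ colorClass χ' j)

/-- All but a vanishing proportion of the colourings cross a given one well: a class that almost
misses the class `i` of `χ` costs a factor `(q / (q + 1)) ^ m i`, up to `μ ^ n` choices of the small
intersection. -/
theorem exists_eventually_card_not_crossWell_le {q : ℕ} (hq : 1 ≤ q) :
    ∃ δ : ℝ, 0 < δ ∧ ∀ η : ℝ, 0 < η → ∀ᶠ n : ℕ in atTop, ∀ m : Fin (q + 1) → ℕ,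
      IsNearlyEqual (q + 1) n m → ∀ χ ∈ coloringsOfSizes (Fin n) m,
      open Classical in
      (#{χ' ∈ coloringsOfSizes (Fin n) m | ¬ CrossWell δ χ χ'} : ℝ) ≤
        η * #(coloringsOfSizes (Fin n) m) := by
  classical
  have hq0 : (0 : ℝ) < q := by exact_mod_cast hq
  set t : ℝ := q + 1 with ht
  have ht0 : 0 < t := by positivity
  set β : ℝ := (q / t) ^ (1 / t) with hβ
  have hqt : q / t < 1 := by rw [div_lt_one ht0]; linarith
  have hβ0 : 0 < β := by positivity
  have hβ1 : β < 1 := Real.rpow_lt_one (by positivity) hqt (by positivity)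
  obtain ⟨μ, hμ1, hμ⟩ : ∃ μ, 1 < μ ∧ μ < 1 / β := exists_between (by rw [lt_div_iff₀ hβ0]; linarith)
  obtain ⟨δ, hδ, hsmall⟩ := exists_card_small_sets_le hμ1
  refine ⟨δ, hδ, fun η hη => ?_⟩
  have hb : μ * β * t < (q + 1 : ℕ) := by
    rw [lt_div_iff₀ hβ0] at hμ
    push_cast
    calc μ * β * t < 1 * t := by gcongr
      _ = _ := one_mul _
  have hev := eventually_mul_pow_le_card (t := q + 1) (by omega) (b := μ * β * t)
    (by positivity) hb (C := t ^ 2 * (q / t) ^ (-2 : ℝ)) hη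
  filter_upwards [hev] with n hn m hm χ hχ
  refine le_trans ?_ (hn m hm)
  rw [mem_coloringsOfSizes] at hχ
  set Sm : Finset (Finset (Fin n)) := {T | (#T : ℝ) ≤ δ * n}
  have hsub : ({χ' ∈ coloringsOfSizes (Fin n) m | ¬ CrossWell δ χ χ'} :
      Finset (Fin n → Fin (q + 1))) ⊆
      (Finset.univ : Finset (Fin (q + 1) × Fin (q + 1))).biUnion fun p => Sm.biUnion fun T =>
        {χ' | colorClass χ p.1 ∩ colorClass χ' p.2 = T} := by
    intro χ' h
    simp only [Finset.mem_filter, CrossWell, not_forall, not_le] at h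
    obtain ⟨-, i, j, hij⟩ := h
    simp only [Finset.mem_biUnion, Finset.mem_univ, true_and, Finset.mem_filter, Sm]
    exact ⟨(i, j), _, hij.le, rfl⟩
  have hcell : ∀ p : Fin (q + 1) × Fin (q + 1), ∀ T, (#{χ' : Fin n → Fin (q + 1) |
      colorClass χ p.1 ∩ colorClass χ' p.2 = T} : ℝ) ≤ (q / t) ^ (-2 : ℝ) * (β * t) ^ n := by
    intro p T
    have h1 := card_colorings_cell_le q hq (I := Fin (q + 1)) (by simp) (colorClass χ p.1) p.2 T
    rw [hχ, Fintype.card_fin] at h1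
    have h2 : (#{χ' : Fin n → Fin (q + 1) | colorClass χ p.1 ∩ colorClass χ' p.2 = T} : ℝ) ≤
      (q : ℝ) ^ m p.1 * t ^ (n - m p.1) := by rw [ht]; exact_mod_cast h1
    refine h2.trans ?_
    have h3 : (q : ℝ) ^ m p.1 * t ^ (n - m p.1) = (q / t) ^ (m p.1) * t ^ n := by
      rw [div_pow, ← Nat.sub_add_cancel (hm.le p.1), pow_add]
      field_simp
      rw [Nat.sub_add_cancel (hm.le p.1)]
    rw [h3, mul_pow, ← mul_assoc]
    gcongr
    rw [hβ, ← Real.rpow_natCast, ← Real.rpow_natCast, ← Real.rpow_mul (by positivity),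
      ← Real.rpow_add (by positivity)]
    refine Real.rpow_le_rpow_of_exponent_ge (by positivity) hqt.le ?_
    have := hm.sub_le p.1
    push_cast at this
    rw [← ht] at this
    calc -2 + 1 / t * n = n / t - 2 := by ring
      _ ≤ _ := this
  calc (#{χ' ∈ coloringsOfSizes (Fin n) m | ¬ CrossWell δ χ χ'} : ℝ)
      ≤ ∑ p : Fin (q + 1) × Fin (q + 1), ∑ T ∈ Sm, (#{χ' : Fin n → Fin (q + 1) |
      colorClass χ p.1 ∩ colorClass χ' p.2 = T} : ℝ) := by
        refine (Nat.cast_le.2 ((Finset.card_le_card hsub).trans Finset.card_biUnion_le)).trans ?_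
        push_cast
        refine Finset.sum_le_sum fun p _ => ?_
        exact_mod_cast Finset.card_biUnion_le
    _ ≤ ∑ p : Fin (q + 1) × Fin (q + 1), ∑ T ∈ Sm, (q / t) ^ (-2 : ℝ) * (β * t) ^ n :=
        Finset.sum_le_sum fun p _ => Finset.sum_le_sum fun T _ => hcell p T
    _ = t ^ 2 * (#Sm * ((q / t) ^ (-2 : ℝ) * (β * t) ^ n)) := by
        simp only [Finset.sum_const, Finset.card_univ, Fintype.card_prod, Fintype.card_fin,
          nsmul_eq_mul]
        rw [ht]; push_cast; ring
    _ ≤ t ^ 2 * (μ ^ n * ((q / t) ^ (-2 : ℝ) * (β * t) ^ n)) := by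
        gcongr
        exact hsmall n
    _ = _ := by rw [mul_assoc μ, mul_pow μ]; ring

/-- The colours `j` for which the class of `j` in `χ'` nearly coincides with a class of `χ`. For
nearly equal class sizes it does not matter which of the two differences is small. -/
noncomputable def nearColors (ε : ℝ) {n : ℕ} (χ χ' : Fin n → I) : Finset I :=
  open Classical in
  {j | ∃ i, (#(colorClass χ i \ colorClass χ' j) : ℝ) < ε * n ∨
    (#(colorClass χ' j \ colorClass χ i) : ℝ) < ε * n}

/-- If the classes of the colours in `S ≠ ∅` are prescribed, then at most `q` colours are left for
each of the other vertices. -/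
lemma card_colorings_agree_le {q : ℕ} (hI : Fintype.card I = q + 1) {S : Finset I}
    (hS : S.Nonempty) (m : I → ℕ) (D : I → Finset V) :
    #{χ ∈ coloringsOfSizes V m | ∀ j ∈ S, colorClass χ j = D j} ≤ q ^ (∑ j ∈ Sᶜ, m j) := by
  classical
  by_cases hne : ({χ ∈ coloringsOfSizes V m | ∀ j ∈ S, colorClass χ j = D j} : Finset _).Nonempty
  swap
  · rw [Finset.not_nonempty_iff_eq_empty.1 hne]; simp
  obtain ⟨χ₀, h₀⟩ := hne
  rw [Finset.mem_filter, mem_coloringsOfSizes] at h₀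
  have hsub : ({χ ∈ coloringsOfSizes V m | ∀ j ∈ S, colorClass χ j = D j} : Finset (V → I)) ⊆
      Fintype.piFinset (fun v => if χ₀ v ∈ S then {χ₀ v} else Sᶜ) := by
    intro χ hχ
    rw [Finset.mem_filter] at hχ
    rw [Fintype.mem_piFinset]
    intro v
    have hv : ∀ j ∈ S, χ v = j ↔ χ₀ v = j := by
      intro j hj
      rw [← mem_colorClass, ← mem_colorClass, hχ.2 j hj, h₀.2 j hj]
    split_ifs with h
    · simpa using (hv _ h).2 rfl
    · rw [Finset.mem_compl]
      intro h'
      exact h ((hv _ h').1 rfl ▸ h')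
  refine (Finset.card_le_card hsub).trans ?_
  rw [Fintype.card_piFinset]
  have hSc : #Sᶜ ≤ q := by
    rw [Finset.card_compl, hI]
    have := hS.card_pos
    omega
  calc _ ≤ ∏ v : V, (if χ₀ v ∈ Sᶜ then q else 1) := by
        refine Finset.prod_le_prod' fun v _ => ?_
        by_cases h : χ₀ v ∈ S <;> simp [h, hSc]
    _ = q ^ (∑ j ∈ Sᶜ, m j) := by
        rw [Finset.prod_ite, Finset.prod_const, Finset.prod_const_one, mul_one]
        congr 1
        rw [Finset.card_eq_sum_card_fiberwise (f := χ₀) (t := Sᶜ) (fun v hv => by simpa using hv)]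
        refine Finset.sum_congr rfl fun j hj => ?_
        rw [← h₀.1 j, Finset.filter_filter]
        congr 1
        ext v
        simp only [Finset.mem_filter, Finset.mem_univ, true_and, mem_colorClass]
        exact ⟨fun h => h.2, fun h => ⟨h ▸ hj, h⟩⟩

/-- Each class with colour in `S` is the symmetric difference of a class of `χ` and a small set, so
there are at most `((q + 1) * μ ^ n) ^ (q + 1)` choices for these classes. -/
theorem card_nearColors_eq_le {q n : ℕ} {ε δ μ : ℝ} (hεδ : 2 * ε * n + 4 ≤ δ * n) (hμ : 1 ≤ μ)
    (hδ : (#{T : Finset (Fin n) | (#T : ℝ) ≤ δ * n} : ℝ) ≤ μ ^ n)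
    {m : Fin (q + 1) → ℕ} (hm : IsNearlyEqual (q + 1) n m) {χ : Fin n → Fin (q + 1)}
    (hχ : χ ∈ coloringsOfSizes (Fin n) m) {S : Finset (Fin (q + 1))} (hS : S.Nonempty) :
    open Classical in
    (#{χ' ∈ coloringsOfSizes (Fin n) m | nearColors ε χ χ' = S} : ℝ) ≤
      ((q + 1 : ℝ) * μ ^ n) ^ (q + 1) * (q : ℝ) ^ (∑ j ∈ Sᶜ, m j) := by
  classical
  set Sm : Finset (Finset (Fin n)) := {T | (#T : ℝ) ≤ δ * n}
  set 𝒞 : Finset (Finset (Fin n)) :=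
    (Finset.univ ×ˢ Sm).image fun p : Fin (q + 1) × Finset (Fin n) =>
      symmDiff (colorClass χ p.1) p.2 with h𝒞
  set 𝒟 : Finset (Fin (q + 1) → Finset (Fin n)) :=
    Fintype.piFinset fun j => if j ∈ S then 𝒞 else {∅} with h𝒟
  have hsub : ({χ' ∈ coloringsOfSizes (Fin n) m | nearColors ε χ χ' = S} : Finset _) ⊆
      𝒟.biUnion fun D => {χ' ∈ coloringsOfSizes (Fin n) m | ∀ j ∈ S, colorClass χ' j = D j} := by
    intro χ' h
    rw [Finset.mem_filter] at h
    rw [Finset.mem_biUnion]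
    refine ⟨fun j => if j ∈ S then colorClass χ' j else ∅, ?_, ?_⟩
    · rw [h𝒟, Fintype.mem_piFinset]
      intro j
      by_cases hj : j ∈ S
      swap
      · simp [hj]
      simp only [hj, if_true]
      have hj' := hj
      rw [← h.2] at hj'
      simp only [nearColors, Finset.mem_filter, Finset.mem_univ, true_and] at hj'
      obtain ⟨i, hi⟩ := hj'
      rw [h𝒞, Finset.mem_image]
      refine ⟨(i, symmDiff (colorClass χ i) (colorClass χ' j)), ?_,
        symmDiff_symmDiff_cancel_left _ _⟩
      simp only [Finset.mem_product, Finset.mem_univ, true_and, Sm, Finset.mem_filter]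
      have h1 : #(symmDiff (colorClass χ i) (colorClass χ' j)) ≤
          #(colorClass χ i \ colorClass χ' j) + #(colorClass χ' j \ colorClass χ i) := by
        rw [symmDiff_def]; exact Finset.card_union_le _ _
      have h1' : (#(symmDiff (colorClass χ i) (colorClass χ' j)) : ℝ) ≤
          #(colorClass χ i \ colorClass χ' j) + #(colorClass χ' j \ colorClass χ i) := by
        exact_mod_cast h1
      have h2 := Finset.card_sdiff_add_card_inter (colorClass χ i) (colorClass χ' j)
      have h3 := Finset.card_sdiff_add_card_inter (colorClass χ' j) (colorClass χ i)
      rw [Finset.inter_comm, mem_coloringsOfSizes.1 h.1] at h3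
      rw [mem_coloringsOfSizes.1 hχ] at h2
      have h2' : (#(colorClass χ i \ colorClass χ' j) : ℝ) +
        #(colorClass χ i ∩ colorClass χ' j) = m i := by exact_mod_cast h2
      have h3' : (#(colorClass χ' j \ colorClass χ i) : ℝ) +
        #(colorClass χ i ∩ colorClass χ' j) = m j := by exact_mod_cast h3
      have := hm.le_add i
      have := hm.le_add j
      have := hm.sub_le i
      have := hm.sub_le j
      rcases hi with hi | hi <;> linarith
    · rw [Finset.mem_filter]
      refine ⟨h.1, fun j hj => ?_⟩
      simp [hj]
  have hC : (#𝒞 : ℝ) ≤ (q + 1 : ℝ) * μ ^ n := by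
    have h1 : #𝒞 ≤ (q + 1) * #Sm := by
      refine Finset.card_image_le.trans ?_
      rw [Finset.card_product]; simp
    calc (#𝒞 : ℝ) ≤ (q + 1) * #Sm := by exact_mod_cast h1
      _ ≤ _ := by gcongr
  have hone : 1 ≤ (q + 1 : ℝ) * μ ^ n :=
    one_le_mul_of_one_le_of_one_le (by simp) (one_le_pow₀ hμ)
  have hD : (#𝒟 : ℝ) ≤ ((q + 1 : ℝ) * μ ^ n) ^ (q + 1) := by
    rw [h𝒟, Fintype.card_piFinset]
    push_cast
    calc _ ≤ ∏ j : Fin (q + 1), ((q + 1 : ℝ) * μ ^ n) := by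
          refine Finset.prod_le_prod (fun _ _ => by positivity) fun j _ => ?_
          split_ifs
          · exact hC
          · simpa using hone
      _ = _ := by simp
  calc (#{χ' ∈ coloringsOfSizes (Fin n) m | nearColors ε χ χ' = S} : ℝ)
      ≤ ∑ D ∈ 𝒟, (#{χ' ∈ coloringsOfSizes (Fin n) m | ∀ j ∈ S, colorClass χ' j = D j} : ℝ) := by
        exact_mod_cast (Finset.card_le_card hsub).trans Finset.card_biUnion_le
    _ ≤ ∑ D ∈ 𝒟, (q : ℝ) ^ (∑ j ∈ Sᶜ, m j) := by
        refine Finset.sum_le_sum fun D _ => ?_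
        have h := card_colorings_agree_le (V := Fin n) (q := q) (by simp) hS m D
        have h' : #{χ' ∈ coloringsOfSizes (Fin n) m | ∀ j ∈ S, colorClass χ' j = D j} ≤
            q ^ (∑ j ∈ Sᶜ, m j) := by convert h
        exact_mod_cast h'
    _ = #𝒟 * (q : ℝ) ^ (∑ j ∈ Sᶜ, m j) := by simp
    _ ≤ _ := by gcongr

end Counting

/-! ### The second moment inequality -/

section GraphProb

variable {V : Type*} [Fintype V] [LinearOrder V]

lemma graphProb_nonneg (p : SimpleGraph V → Prop) : 0 ≤ graphProb p := by
  unfold graphProb; positivity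

lemma graphProb_mono {p p' : SimpleGraph V → Prop} (h : ∀ G, p G → p' G) :
    graphProb p ≤ graphProb p' := by
  unfold graphProb
  gcongr
  exact h _

/-- The second moment inequality `E[X]² ≤ P(X > 0) E[X²]` for the number `X` of the events `E χ`
that occur. -/
lemma sq_sum_graphProb_le {ι : Type*} (F : Finset ι) (E : ι → SimpleGraph V → Prop) :
    (∑ χ ∈ F, graphProb (E χ)) ^ 2 ≤ graphProb (fun G => ∃ χ ∈ F, E χ G) *
      ∑ χ ∈ F, ∑ χ' ∈ F, graphProb (fun G => E χ G ∧ E χ' G) := by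
  classical
  have hpos : (0 : ℝ) < Fintype.card (SimpleGraph V) := by exact_mod_cast Fintype.card_pos
  let X : SimpleGraph V → ℝ := fun G => ∑ χ ∈ F, if E χ G then 1 else 0
  set s : Finset (SimpleGraph V) := {G | ∃ χ ∈ F, E χ G} with hs
  have h1 : ∑ χ ∈ F, graphProb (E χ) = (∑ G ∈ s, X G) / Fintype.card (SimpleGraph V) := by
    have : ∑ G ∈ s, X G = ∑ G, X G := by
      refine Finset.sum_subset (Finset.subset_univ _) fun G _ hG => ?_
      simp only [hs, Finset.mem_filter, Finset.mem_univ, true_and, not_exists, not_and] at hG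
      exact Finset.sum_eq_zero fun χ hχ => if_neg (hG χ hχ)
    rw [this, Finset.sum_comm, Finset.sum_div]
    refine Finset.sum_congr rfl fun χ _ => ?_
    rw [graphProb, Finset.natCast_card_filter]
  have h2 : ∑ χ ∈ F, ∑ χ' ∈ F, graphProb (fun G => E χ G ∧ E χ' G) =
      (∑ G, X G ^ 2) / Fintype.card (SimpleGraph V) := by
    have : ∀ G, X G ^ 2 = ∑ χ ∈ F, ∑ χ' ∈ F, if E χ G ∧ E χ' G then 1 else 0 := by
      intro G
      simp only [X]
      rw [sq, Finset.sum_mul_sum F F]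
      refine Finset.sum_congr rfl fun χ _ => Finset.sum_congr rfl fun χ' _ => ?_
      by_cases h1 : E χ G <;> by_cases h2 : E χ' G <;> simp [h1, h2]
    simp only [this]
    symm
    rw [Finset.sum_comm, Finset.sum_div]
    refine Finset.sum_congr rfl fun χ _ => ?_
    rw [Finset.sum_comm, Finset.sum_div]
    refine Finset.sum_congr rfl fun χ' _ => ?_
    rw [graphProb, Finset.natCast_card_filter]
    congr!
  have h3 : (∑ G ∈ s, X G) ^ 2 ≤ #s * ∑ G, X G ^ 2 := by
    refine sq_sum_le_card_mul_sum_sq.trans ?_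
    gcongr
    exact Finset.subset_univ _
  have h4 : graphProb (fun G => ∃ χ ∈ F, E χ G) = #s / Fintype.card (SimpleGraph V) := by
    rw [graphProb]
    congr!
  rw [h1, h2, h4, div_pow, div_mul_div_comm, sq (Fintype.card _ : ℝ)]
  gcongr

end GraphProb

/-! ### The family of classes of two colourings -/

section Pairs

variable {V I : Type*} [Fintype V] [LinearOrder V] [Fintype I] [DecidableEq I]

/-- The classes of `χ` together with the classes of `χ'` whose colour is not in `S`. The latter are
replaced by `∅` for the colours in `S`, so that no condition is imposed on them. -/
def pairFamily (χ χ' : V → I) (S : Finset I) : I ⊕ I → Finset V :=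
  Sum.elim (colorClass χ) fun j => if j ∈ S then ∅ else colorClass χ' j

omit [LinearOrder V] [Fintype I] in
lemma familyDegreesMod_pairFamily {G : SimpleGraph V} {q r : ℕ} {χ χ' : V → I} (S : Finset I)
    (h : FamilyDegreesMod G q r (colorClass χ)) (h' : FamilyDegreesMod G q r (colorClass χ')) :
    FamilyDegreesMod G q r (pairFamily χ χ' S) := by
  rintro (i | j) v hv
  · exact h i v hv
  · by_cases hj : j ∈ S
    · simp [pairFamily, hj] at hv
    · simp only [pairFamily, hj, Sum.elim_inr, if_false] at hv ⊢
      exact h' j v hv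

lemma sum_card_pairFamily {m : I → ℕ} {χ χ' : V → I} (hχ : χ ∈ coloringsOfSizes V m)
    (hχ' : χ' ∈ coloringsOfSizes V m) (S : Finset I) :
    ∑ k, #(pairFamily χ χ' S k) = ∑ i, m i + ∑ j ∈ Sᶜ, m j := by
  rw [mem_coloringsOfSizes] at hχ hχ'
  rw [Fintype.sum_sum_type]
  congr 1
  · exact Finset.sum_congr rfl fun i _ => hχ i
  · rw [← Finset.sum_filter_add_sum_filter_not Finset.univ (· ∈ S), Finset.sum_eq_zero, zero_add]
    · refine Finset.sum_congr (by ext; simp) fun j hj => ?_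
      rw [Finset.mem_compl] at hj
      simp [pairFamily, hj, hχ']
    · intro j hj
      rw [Finset.mem_filter] at hj
      simp [pairFamily, hj.2]

lemma mem_privateNeighbors_pairFamily_inl {χ χ' : V → I} {S : Finset I} {u v : V} {i : I}
    (hv : χ v = i) (hu : χ u = i) (h : χ' v ∈ S ∨ χ' u ≠ χ' v) :
    u ∈ privateNeighbors (pairFamily χ χ' S) v (Sum.inl i) := by
  rw [privateNeighbors, Finset.mem_filter]
  refine ⟨mem_colorClass.2 hu, ?_⟩
  rintro (i' | j) hk ⟨h1, h2⟩
  · apply hk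
    rw [← hv, ← mem_colorClass.1 h1]
  · by_cases hj : j ∈ S
    · simp [pairFamily, hj] at h1
    · simp only [pairFamily, hj, Sum.elim_inr, if_false, mem_colorClass] at h1 h2
      subst h1
      exact h.elim hj fun h' => h' h2

lemma mem_privateNeighbors_pairFamily_inr {χ χ' : V → I} {S : Finset I} {u v : V} {j : I}
    (hj : j ∉ S) (hv : χ' v = j) (hu : χ' u = j) (h : χ u ≠ χ v) :
    u ∈ privateNeighbors (pairFamily χ χ' S) v (Sum.inr j) := by
  rw [privateNeighbors, Finset.mem_filter]
  refine ⟨by simp [pairFamily, hj, mem_colorClass, hu], ?_⟩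
  rintro (i' | j') hk ⟨h1, h2⟩
  · apply h
    rw [mem_colorClass.1 h1, mem_colorClass.1 h2]
  · by_cases hj' : j' ∈ S
    · simp [pairFamily, hj'] at h1
    · simp only [pairFamily, hj', Sum.elim_inr, if_false, mem_colorClass] at h1 h2
      exact hk (by rw [← h1, hv])

lemma mem_privateNeighbors_colorClass {χ : V → I} {u v : V} {i : I} (hv : χ v = i) (hu : χ u = i) :
    u ∈ privateNeighbors (colorClass χ) v i := by
  rw [privateNeighbors, Finset.mem_filter]
  refine ⟨mem_colorClass.2 hu, fun k hk h => hk ?_⟩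
  rw [← hv, ← mem_colorClass.1 h.1]

lemma le_card_privateNeighbors_pairFamily {n : ℕ} {ε : ℝ} {χ χ' : Fin n → I}
    (hsize : ∀ i, ε * n ≤ #(colorClass χ i)) (k : I ⊕ I) {v : Fin n}
    (hv : v ∈ pairFamily χ χ' (nearColors ε χ χ') k) :
    ε * n ≤ #(privateNeighbors (pairFamily χ χ' (nearColors ε χ χ')) v k) := by
  have hfar : ∀ j ∉ nearColors ε χ χ', ∀ i, ε * n ≤ #(colorClass χ i \ colorClass χ' j) ∧
      ε * n ≤ #(colorClass χ' j \ colorClass χ i) := by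
    intro j hj i
    simp only [nearColors, Finset.mem_filter, Finset.mem_univ, true_and, not_exists, not_or,
      not_lt] at hj
    exact hj i
  rcases k with i | j
  · have hvi : χ v = i := mem_colorClass.1 hv
    by_cases hS : χ' v ∈ nearColors ε χ χ'
    · refine (hsize i).trans (Nat.cast_le.2 (Finset.card_le_card fun u hu => ?_))
      exact mem_privateNeighbors_pairFamily_inl hvi (mem_colorClass.1 hu) (Or.inl hS)
    · refine (hfar _ hS i).1.trans (Nat.cast_le.2 (Finset.card_le_card fun u hu => ?_))
      rw [Finset.mem_sdiff, mem_colorClass, mem_colorClass] at hu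
      exact mem_privateNeighbors_pairFamily_inl hvi hu.1 (Or.inr hu.2)
  · by_cases hj : j ∈ nearColors ε χ χ'
    · simp [pairFamily, hj] at hv
    · have hvj : χ' v = j := by simpa [pairFamily, hj, mem_colorClass] using hv
      refine (hfar j hj (χ v)).2.trans (Nat.cast_le.2 (Finset.card_le_card fun u hu => ?_))
      rw [Finset.mem_sdiff, mem_colorClass, mem_colorClass] at hu
      exact mem_privateNeighbors_pairFamily_inr hj hvj hu.1 hu.2

/-- With at least three colours, two vertices of a class of `χ` both have as private neighbours the
vertices of that class in a third class of `χ'`, and vice versa. -/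
lemma le_card_inter_privateNeighbors_pairFamily {n : ℕ} {δ : ℝ} {χ χ' : Fin n → I}
    (hI : 3 ≤ Fintype.card I) (hc : CrossWell δ χ χ') (k : I ⊕ I) {v w : Fin n}
    (hv : v ∈ pairFamily χ χ' ∅ k) (hw : w ∈ pairFamily χ χ' ∅ k) :
    δ * n ≤ #(privateNeighbors (pairFamily χ χ' ∅) v k ∩
      privateNeighbors (pairFamily χ χ' ∅) w k) := by
  have hthird : ∀ a b : I, ∃ c, c ≠ a ∧ c ≠ b := by
    intro a b
    have h1 : #({a, b} : Finset I) < Fintype.card I := lt_of_le_of_lt Finset.card_le_two (by omega)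
    by_contra! h
    refine h1.ne (Finset.card_eq_iff_eq_univ _ |>.2 (Finset.eq_univ_of_forall fun c => ?_))
    rw [Finset.mem_insert, Finset.mem_singleton]
    exact or_iff_not_imp_left.2 (h c)
  rcases k with i | j
  · have hvi : χ v = i := mem_colorClass.1 hv
    have hwi : χ w = i := mem_colorClass.1 hw
    obtain ⟨c, h1, h2⟩ := hthird (χ' v) (χ' w)
    refine (hc i c).trans (Nat.cast_le.2 (Finset.card_le_card fun u hu => ?_))
    rw [Finset.mem_inter, mem_colorClass, mem_colorClass] at hu
    rw [Finset.mem_inter]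
    exact ⟨mem_privateNeighbors_pairFamily_inl hvi hu.1 (Or.inr (hu.2 ▸ h1)),
      mem_privateNeighbors_pairFamily_inl hwi hu.1 (Or.inr (hu.2 ▸ h2))⟩
  · have hvj : χ' v = j := by simpa [pairFamily, mem_colorClass] using hv
    have hwj : χ' w = j := by simpa [pairFamily, mem_colorClass] using hw
    obtain ⟨c, h1, h2⟩ := hthird (χ v) (χ w)
    refine (hc c j).trans (Nat.cast_le.2 (Finset.card_le_card fun u hu => ?_))
    rw [Finset.mem_inter, mem_colorClass, mem_colorClass] at hu
    rw [Finset.mem_inter]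
    exact ⟨mem_privateNeighbors_pairFamily_inr (by simp) hvj hu.2 (hu.1 ▸ h1),
      mem_privateNeighbors_pairFamily_inr (by simp) hwj hu.2 (hu.1 ▸ h2)⟩

end Pairs

/-! ### The second moment of the number of good colourings -/

section SecondMoment

/-- The parity condition makes the phase of every two-torsion frequency trivial. -/
lemma mul_mul_eq_zero_of_two_torsion {q r k : ℕ} (h : Even q → Odd r → Even k) {a : ZMod q}
    (ha : a + a = 0) : (r : ZMod q) * (k * a) = 0 := by
  rcases Nat.even_or_odd q with hq | ⟨l, hl⟩
  · have hrk : Even (r * k) := by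
      rcases Nat.even_or_odd r with hr | hr
      · exact hr.mul_right k
      · exact (h hq hr).mul_left r
    obtain ⟨l, hl⟩ := hrk
    rw [← mul_assoc, ← Nat.cast_mul, hl]
    push_cast
    rw [add_mul, ← mul_add, ha, mul_zero]
  · have h1 : ((q : ℕ) : ZMod q) * a = 0 := by simp
    have h2 : ((q : ℕ) : ZMod q) * a = l * (a + a) + a := by
      conv_lhs => rw [show ((q : ℕ) : ZMod q) = ((2 * l + 1 : ℕ) : ZMod q) by rw [← hl]]
      push_cast; ring
    have h3 : a = 0 := by rw [h1, ha, mul_zero, zero_add] at h2; exact h2.symm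
    simp [h3]

/-- A good colouring with given nearly equal class sizes exists with probability tending to `1`,
uniformly in the class sizes. -/
theorem eventually_le_graphProb_coloring {q r : ℕ} (hq : 2 ≤ q) {κ : ℝ} (hκ : κ < 1) :
    ∀ᶠ n : ℕ in atTop, ∀ m : Fin (q + 1) → ℕ, IsNearlyEqual (q + 1) n m →
      (Even q → Odd r → ∀ i, Even (m i)) →
      κ ≤ graphProb (fun G : SimpleGraph (Fin n) =>
        ∃ χ ∈ coloringsOfSizes (Fin n) m, FamilyDegreesMod G q r (colorClass χ)) := by
  classical
  have : NeZero q := ⟨by omega⟩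
  have hq0 : (0 : ℝ) < q := by exact_mod_cast (by omega : 0 < q)
  set t : ℝ := q + 1 with ht
  have ht0 : 0 < t := by positivity
  -- `μ` is chosen so that `μ ^ (q + 1) * q < q + 1`: the `μ ^ n` choices for each of at most
  -- `q + 1` nearly coinciding classes are outweighed by the growth `(q + 1) ^ n` of the number of
  -- colourings.
  set μ : ℝ := ((q + 1 / 2) / q) ^ (((q + 1 : ℕ) : ℝ)⁻¹) with hμ
  have hbase : 1 < ((q : ℝ) + 1 / 2) / q := by rw [one_lt_div hq0]; linarith
  have hμ1 : 1 < μ := Real.one_lt_rpow hbase (by positivity)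
  have hμpow : μ ^ (q + 1) * q = q + 1 / 2 := by
    rw [hμ, Real.rpow_inv_natCast_pow (by positivity) (by omega)]
    field_simp
  obtain ⟨δ, hδ, hsmall⟩ := exists_card_small_sets_le hμ1
  obtain ⟨δ', hδ', hcross⟩ := exists_eventually_card_not_crossWell_le (q := q) (by omega)
  -- Two differences below `ε n` (up to `4`, from unequal sizes) make a symmetric difference of at
  -- most `δ n`; and every class has at least `ε n` vertices.
  set ε : ℝ := min (δ / 4) (1 / (2 * t)) with hε
  have hε0 : 0 < ε := lt_min (by positivity) (by positivity)
  obtain ⟨C, hC, hbound⟩ := exists_graphProb_mul_pow_le (J := Fin (q + 1) ⊕ Fin (q + 1)) q hε0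
  set T : ℝ := (#(twoTorsion q) : ℝ) ^ (q + 1) with hT
  have hT1 : 1 ≤ T := one_le_pow₀ (by exact_mod_cast one_le_card_twoTorsion (q := q))
  -- In the end the probability is at least `(T - η) ^ 2 / (T ^ 2 + (C + 2) * η)`.
  obtain ⟨η, hη0, hη1, hηκ⟩ : ∃ η : ℝ, 0 < η ∧ η < 1 ∧ κ * (T ^ 2 + (C + 2) * η) ≤ (T - η) ^ 2 := by
    have h1 : Tendsto (fun η : ℝ => (T - η) ^ 2 - κ * (T ^ 2 + (C + 2) * η)) (𝓝[>] 0)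
        (𝓝 ((T - 0) ^ 2 - κ * (T ^ 2 + (C + 2) * 0))) := by
      refine (Continuous.tendsto ?_ _).mono_left nhdsWithin_le_nhds
      fun_prop
    have h2 : 0 < (T - 0) ^ 2 - κ * (T ^ 2 + (C + 2) * 0) := by
      have : 0 < (1 - κ) * T ^ 2 := mul_pos (by linarith) (by positivity)
      linarith
    have h3 := (h1.eventually_const_lt h2).and (Ioo_mem_nhdsGT (zero_lt_one (α := ℝ)))
    obtain ⟨η, h4, h5⟩ := h3.exists
    exact ⟨η, h5.1, h5.2, by linarith⟩
  have hnear := eventually_mul_pow_le_card (t := q + 1) (by omega) (b := μ ^ (q + 1) * q)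
    (by positivity) (by rw [hμpow]; push_cast; linarith)
    (C := 2 ^ (q + 1) * (t ^ (q + 1) * C)) hη0
  have hfirst := eventually_abs_graphProb_mul_pow_sub_le (J := Fin (q + 1)) q
    (ε := 1 / (2 * t)) (by positivity) hη0
  have hsecond := eventually_abs_graphProb_mul_pow_sub_le (J := Fin (q + 1) ⊕ Fin (q + 1)) q
    hδ' hη0
  have hlarge : ∀ᶠ n : ℕ in atTop, 8 ≤ δ * n :=
    (tendsto_natCast_atTop_atTop.const_mul_atTop hδ).eventually_ge_atTop 8
  have hlarge2 : ∀ᶠ n : ℕ in atTop, 6 * t ≤ n :=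
    tendsto_natCast_atTop_atTop.eventually_ge_atTop _
  filter_upwards [hcross η hη0, hbound, hnear, hfirst, hsecond, hlarge, hlarge2] with
    n hcross hbound hnear hfirst hsecond hlarge hlarge2 m hm hpar
  set F := coloringsOfSizes (Fin n) m with hF
  set N : ℝ := ((#F : ℕ) : ℝ) with hN
  have hn0 : (0 : ℝ) < n := by linarith
  have hN0 : 0 < N := by
    have := coloringsOfSizes_nonempty (V := Fin n) (m := m) (by rw [hm.sum_eq, Fintype.card_fin])
    exact Nat.cast_pos.2 this.card_pos
  have hmi : ∀ i, 1 / (2 * t) * n ≤ m i ∧ (0 : ℝ) < m i := by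
    intro i
    have h1 := hm.sub_le i
    push_cast at h1
    rw [← ht] at h1
    have h2 : 6 ≤ n / t := by rw [le_div_iff₀ ht0]; exact hlarge2
    have h3 : 1 / (2 * t) * n = n / t / 2 := by field_simp
    rw [h3]
    constructor <;> linarith
  have hpar' : ∀ i, ∀ a : ZMod q, a + a = 0 → (r : ZMod q) * (m i * a) = 0 :=
    fun i a ha => mul_mul_eq_zero_of_two_torsion (fun h1 h2 => hpar h1 h2 i) ha
  have hne : ∀ χ ∈ F, ∀ i, (colorClass χ i).Nonempty := by
    intro χ hχ i
    rw [← Finset.card_pos, mem_coloringsOfSizes.1 hχ]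
    exact_mod_cast (hmi i).2
  set E : (Fin n → Fin (q + 1)) → SimpleGraph (Fin n) → Prop :=
    fun χ G => FamilyDegreesMod G q r (colorClass χ) with hE
  -- The first moment.
  have hEX : ∀ χ ∈ F, T - η ≤ graphProb (E χ) * (q : ℝ) ^ n := by
    intro χ hχ
    have h1 := hfirst r (colorClass χ) (hne χ hχ)
      (fun i a ha => by rw [mem_coloringsOfSizes.1 hχ]; exact hpar' i a ha) ?_
    · rw [Finset.sum_congr rfl fun i _ => mem_coloringsOfSizes.1 hχ i, hm.sum_eq,
        Fintype.card_fin] at h1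
      have := (abs_le.1 h1).1
      linarith
    · intro i v hv w hw
      refine (hmi i).1.trans ?_
      rw [← mem_coloringsOfSizes.1 hχ i]
      refine Nat.cast_le.2 (Finset.card_le_card fun u hu => ?_)
      rw [mem_colorClass] at hu hv hw
      rw [Finset.mem_inter]
      exact ⟨mem_privateNeighbors_colorClass hv hu, mem_privateNeighbors_colorClass hw hu⟩
  -- The second moment, by three bounds: for pairs that cross well, for pairs without nearly
  -- coinciding classes, and for the remaining pairs.
  have hmono : ∀ χ χ' S, graphProb (fun G => E χ G ∧ E χ' G) ≤
      graphProb (fun G => FamilyDegreesMod G q r (pairFamily χ χ' S)) := fun χ χ' S =>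
    graphProb_mono fun G h => familyDegreesMod_pairFamily S h.1 h.2
  have htyp : ∀ χ ∈ F, ∀ χ' ∈ F, CrossWell δ' χ χ' →
      graphProb (fun G => E χ G ∧ E χ' G) * (q : ℝ) ^ (2 * n) ≤ T ^ 2 + η := by
    intro χ hχ χ' hχ' hc
    have h1 := hsecond r (pairFamily χ χ' ∅) ?_ ?_
      (fun k v hv w hw => le_card_inter_privateNeighbors_pairFamily (by simp; omega) hc k hv hw)
    · rw [sum_card_pairFamily hχ hχ', Finset.compl_empty, hm.sum_eq, ← two_mul] at h1
      have h2 := (abs_le.1 h1).2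
      have h3 : (#(twoTorsion q) : ℝ) ^ Fintype.card (Fin (q + 1) ⊕ Fin (q + 1)) = T ^ 2 := by
        rw [hT, ← pow_mul, Fintype.card_sum, Fintype.card_fin, mul_two]
      rw [h3] at h2
      have h4 := mul_le_mul_of_nonneg_right (hmono χ χ' ∅) (by positivity : 0 ≤ (q : ℝ) ^ (2 * n))
      linarith
    · rintro (i | j)
      · exact hne χ hχ i
      · simpa [pairFamily] using hne χ' hχ' j
    · rintro (i | j) a ha
      · simpa [pairFamily, mem_coloringsOfSizes.1 hχ] using hpar' i a ha
      · simpa [pairFamily, mem_coloringsOfSizes.1 hχ'] using hpar' j a ha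
  have hall : ∀ χ ∈ F, ∀ χ' ∈ F, graphProb (fun G => E χ G ∧ E χ' G) *
      (q : ℝ) ^ (n + ∑ j ∈ (nearColors ε χ χ')ᶜ, m j) ≤ C := by
    intro χ hχ χ' hχ'
    have h1 := hbound r (pairFamily χ χ' (nearColors ε χ χ'))
      (fun k v hv => le_card_privateNeighbors_pairFamily (fun i => ?_) k hv)
    · rw [sum_card_pairFamily hχ hχ', hm.sum_eq] at h1
      exact (mul_le_mul_of_nonneg_right (hmono χ χ' _) (by positivity)).trans h1
    · rw [mem_coloringsOfSizes.1 hχ]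
      refine le_trans ?_ (hmi i).1
      gcongr
      exact min_le_right _ _
  have hpoint : ∀ χ ∈ F, ∀ χ' ∈ F, graphProb (fun G => E χ G ∧ E χ' G) * (q : ℝ) ^ (2 * n) ≤
      (T ^ 2 + η) + (if CrossWell δ' χ χ' then 0 else C) +
      ∑ S ∈ Finset.univ.erase ∅, if nearColors ε χ χ' = S then
        C * (q : ℝ) ^ n / (q : ℝ) ^ (∑ j ∈ Sᶜ, m j) else 0 := by
    intro χ hχ χ' hχ'
    have hnn : 0 ≤ ∑ S ∈ Finset.univ.erase ∅, if nearColors ε χ χ' = S then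
        C * (q : ℝ) ^ n / (q : ℝ) ^ (∑ j ∈ Sᶜ, m j) else 0 := by
      refine Finset.sum_nonneg fun S _ => ?_
      split_ifs <;> positivity
    have hTη : 0 ≤ T ^ 2 + η := by positivity
    by_cases hc : CrossWell δ' χ χ'
    · have := htyp χ hχ χ' hχ' hc
      rw [if_pos hc]; linarith
    rw [if_neg hc]
    have h1 := hall χ hχ χ' hχ'
    by_cases hS : nearColors ε χ χ' = ∅
    · rw [hS, Finset.compl_empty, hm.sum_eq, ← two_mul] at h1
      linarith
    · rw [Finset.sum_ite_eq, if_pos (by simpa using hS)]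
      have h2 : graphProb (fun G => E χ G ∧ E χ' G) * (q : ℝ) ^ (2 * n) ≤
          C * (q : ℝ) ^ n / (q : ℝ) ^ (∑ j ∈ (nearColors ε χ χ')ᶜ, m j) := by
        rw [le_div_iff₀ (by positivity)]
        calc _ = (graphProb (fun G => E χ G ∧ E χ' G) *
              (q : ℝ) ^ (n + ∑ j ∈ (nearColors ε χ χ')ᶜ, m j)) * (q : ℝ) ^ n := by
              rw [two_mul, pow_add, pow_add]; ring
          _ ≤ _ := by gcongr
      linarith
  have hrow : ∀ χ ∈ F, ∑ χ' ∈ F, graphProb (fun G => E χ G ∧ E χ' G) * (q : ℝ) ^ (2 * n) ≤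
      N * (T ^ 2 + (C + 2) * η) := by
    intro χ hχ
    refine (Finset.sum_le_sum fun χ' hχ' => hpoint χ hχ χ' hχ').trans ?_
    rw [Finset.sum_add_distrib, Finset.sum_add_distrib]
    have h1 : ∑ χ' ∈ F, (T ^ 2 + η) = N * (T ^ 2 + η) := by
      rw [Finset.sum_const, nsmul_eq_mul]
    have h2 : ∑ χ' ∈ F, (if CrossWell δ' χ χ' then 0 else C) ≤ C * (η * N) := by
      rw [Finset.sum_congr rfl fun χ' _ => (ite_not (CrossWell δ' χ χ') C 0).symm,
        ← Finset.sum_filter, Finset.sum_const, nsmul_eq_mul, mul_comm]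
      gcongr
      exact hcross m hm χ hχ
    have h3 : ∑ χ' ∈ F, ∑ S ∈ Finset.univ.erase ∅, (if nearColors ε χ χ' = S then
        C * (q : ℝ) ^ n / (q : ℝ) ^ (∑ j ∈ Sᶜ, m j) else 0) ≤ η * N := by
      refine le_trans ?_ (hnear m hm)
      rw [Finset.sum_comm]
      calc _ ≤ ∑ S ∈ (Finset.univ : Finset (Finset (Fin (q + 1)))).erase ∅,
            ((t * μ ^ n) ^ (q + 1)) * (C * (q : ℝ) ^ n) := by
            refine Finset.sum_le_sum fun S hS => ?_
            rw [← Finset.sum_filter, Finset.sum_const, nsmul_eq_mul]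
            have hSne : S.Nonempty := Finset.nonempty_iff_ne_empty.2 (Finset.ne_of_mem_erase hS)
            have h5 := card_nearColors_eq_le (ε := ε) (δ := δ) (μ := μ) (χ := χ) ?_ hμ1.le
              (hsmall n) hm hχ hSne
            · calc _ ≤ ((q + 1 : ℝ) * μ ^ n) ^ (q + 1) * (q : ℝ) ^ (∑ j ∈ Sᶜ, m j) *
                    (C * (q : ℝ) ^ n / (q : ℝ) ^ (∑ j ∈ Sᶜ, m j)) := by gcongr
                _ = _ := by rw [← ht]; field_simp
            · have h6 : ε ≤ δ / 4 := min_le_left _ _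
              have h7 : ε * n ≤ δ / 4 * n := by gcongr
              linarith
        _ ≤ ∑ S : Finset (Fin (q + 1)), ((t * μ ^ n) ^ (q + 1)) * (C * (q : ℝ) ^ n) :=
            Finset.sum_le_sum_of_subset_of_nonneg (Finset.erase_subset _ _)
              fun _ _ _ => by positivity
        _ = _ := by
            rw [Finset.sum_const, Finset.card_univ, Fintype.card_finset, Fintype.card_fin,
              nsmul_eq_mul, mul_pow t, ← pow_mul, mul_comm n, pow_mul, mul_pow _ (q : ℝ)]
            push_cast; ring
    rw [h1]
    linarith
  have hcs := sq_sum_graphProb_le F E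
  set p := graphProb (fun G => ∃ χ ∈ F, E χ G) with hp
  have hEX' : N * (T - η) ≤ (∑ χ ∈ F, graphProb (E χ)) * (q : ℝ) ^ n := by
    rw [Finset.sum_mul, ← nsmul_eq_mul]
    exact Finset.card_nsmul_le_sum _ _ _ hEX
  have hEX2 : (∑ χ ∈ F, ∑ χ' ∈ F, graphProb (fun G => E χ G ∧ E χ' G)) * (q : ℝ) ^ (2 * n) ≤
      N * (N * (T ^ 2 + (C + 2) * η)) := by
    rw [Finset.sum_mul, ← nsmul_eq_mul]
    refine Finset.sum_le_card_nsmul _ _ _ fun χ hχ => ?_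
    rw [Finset.sum_mul]
    exact hrow χ hχ
  have hp0 : 0 ≤ p := graphProb_nonneg _
  have hD : 0 < T ^ 2 + (C + 2) * η := by positivity
  have hfinal : N ^ 2 * (T - η) ^ 2 ≤ N ^ 2 * (p * (T ^ 2 + (C + 2) * η)) := by
    calc N ^ 2 * (T - η) ^ 2 = (N * (T - η)) ^ 2 := by ring
      _ ≤ ((∑ χ ∈ F, graphProb (E χ)) * (q : ℝ) ^ n) ^ 2 := by
          have : 0 ≤ N * (T - η) := mul_nonneg hN0.le (by linarith)
          gcongr
      _ = (∑ χ ∈ F, graphProb (E χ)) ^ 2 * (q : ℝ) ^ (2 * n) := by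
          rw [mul_pow, ← pow_mul, mul_comm n]
      _ ≤ (p * ∑ χ ∈ F, ∑ χ' ∈ F, graphProb (fun G => E χ G ∧ E χ' G)) * (q : ℝ) ^ (2 * n) := by
          gcongr
      _ = p * ((∑ χ ∈ F, ∑ χ' ∈ F, graphProb (fun G => E χ G ∧ E χ' G)) *
          (q : ℝ) ^ (2 * n)) := by ring
      _ ≤ p * (N * (N * (T ^ 2 + (C + 2) * η))) := by gcongr
      _ = _ := by ring
  have h8 := le_of_mul_le_mul_left hfinal (by positivity)
  exact le_of_mul_le_mul_right (hηκ.trans h8) hD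

end SecondMoment

/-! ### From colourings to partitions of the random graph -/

section Transfer

/-- At density `1/2` all graphs are equally likely. -/
lemma randomGraphHalf_apply (n : ℕ) (p : SimpleGraph (Fin n) → Prop) :
    randomGraphHalf n {G | p G} = ENNReal.ofReal (graphProb p) := by
  classical
  have hprob : MeasureTheory.IsProbabilityMeasure (randomGraphHalf n) := by
    unfold randomGraphHalf; infer_instance
  have hsing : ∀ G : SimpleGraph (Fin n),
      randomGraphHalf n {G} = (2⁻¹ : ENNReal) ^ (n.choose 2) := by
    intro G
    have hp : ((unitInterval.toNNReal ⟨1 / 2, by norm_num, by norm_num⟩ : NNReal) :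
        ENNReal) = 2⁻¹ := by
      have : unitInterval.toNNReal ⟨1 / 2, by norm_num, by norm_num⟩ = (2⁻¹ : NNReal) := by
        ext; simp [unitInterval.toNNReal]; rfl
      rw [this]; simp
    have hp' : ((unitInterval.toNNReal
        (unitInterval.symm ⟨1 / 2, by norm_num, by norm_num⟩) : NNReal) : ENNReal) = 2⁻¹ := by
      have : unitInterval.toNNReal
          (unitInterval.symm ⟨1 / 2, by norm_num, by norm_num⟩) = (2⁻¹ : NNReal) := by
        ext; simp [unitInterval.toNNReal]; norm_num; rfl
      rw [this]; simp
    rw [randomGraphHalf, SimpleGraph.binomialRandom_singleton, hp, hp', ← pow_add, Nat.card_fin]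
    congr 1
    have := G.card_edgeFinset_le_card_choose_two
    rw [Fintype.card_fin] at this
    rw [← SimpleGraph.coe_edgeFinset, Set.ncard_coe_finset]
    omega
  have : MeasurableSingletonClass (SimpleGraph (Fin n)) := ⟨fun G => by
    convert SimpleGraph.measurable_edgeSet (measurableSet_singleton G.edgeSet)
    ext H; simp⟩
  have hcount : ∀ s : Finset (SimpleGraph (Fin n)),
      randomGraphHalf n s = #s * (2⁻¹ : ENNReal) ^ (n.choose 2) := by
    intro s
    rw [← MeasureTheory.sum_measure_singleton, Finset.sum_congr rfl fun G _ => hsing G,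
      Finset.sum_const, nsmul_eq_mul]
  have huniv := hcount Finset.univ
  rw [Finset.coe_univ, MeasureTheory.measure_univ, Finset.card_univ] at huniv
  have hcard : (Fintype.card (SimpleGraph (Fin n)) : ENNReal) ≠ 0 := by
    exact_mod_cast Fintype.card_ne_zero
  have hinv : (2⁻¹ : ENNReal) ^ (n.choose 2) = (Fintype.card (SimpleGraph (Fin n)) : ENNReal)⁻¹ :=
    ENNReal.eq_inv_of_mul_eq_one_left (by rw [mul_comm]; exact huniv.symm)
  have hset : {G : SimpleGraph (Fin n) | p G} =
      (({G | p G} : Finset (SimpleGraph (Fin n))) : Set _) := by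
    ext; simp
  rw [hset, hcount, hinv, graphProb, ENNReal.ofReal_div_of_pos (by exact_mod_cast Fintype.card_pos),
    ENNReal.ofReal_natCast, ENNReal.ofReal_natCast, ENNReal.div_eq_inv_mul, mul_comm]

/-- The partition into the classes of a colouring. -/
def colorPartition {V I : Type*} [Fintype V] [DecidableEq V] [Fintype I] [DecidableEq I]
    (χ : V → I) (hχ : ∀ i, (colorClass χ i).Nonempty) :
    Finpartition (Finset.univ : Finset V) :=
  Finpartition.ofExistsUnique (Finset.univ.image (colorClass χ)) (fun _ _ => Finset.subset_univ _)
    (fun v _ => by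
      refine ⟨colorClass χ (χ v), ⟨by simp, by simp [mem_colorClass]⟩, ?_⟩
      rintro A ⟨hA, hv⟩
      rw [Finset.mem_image] at hA
      obtain ⟨i, -, rfl⟩ := hA
      rw [mem_colorClass.1 hv])
    (fun h => by
      rw [Finset.mem_image] at h
      obtain ⟨i, -, hi⟩ := h
      exact (hχ i).ne_empty hi)

variable {V I : Type*} [Fintype V] [DecidableEq V] [Fintype I] [DecidableEq I]

lemma mem_parts_colorPartition {χ : V → I} {hχ : ∀ i, (colorClass χ i).Nonempty} {A : Finset V} :
    A ∈ (colorPartition χ hχ).parts ↔ ∃ i, colorClass χ i = A := by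
  simp [colorPartition, Finpartition.ofExistsUnique]

lemma card_parts_colorPartition {χ : V → I} (hχ : ∀ i, (colorClass χ i).Nonempty) :
    #(colorPartition χ hχ).parts = Fintype.card I := by
  change #(Finset.univ.image (colorClass χ)) = _
  rw [Finset.card_image_of_injective, Finset.card_univ]
  intro i j hij
  obtain ⟨v, hv⟩ := hχ i
  have hv' : v ∈ colorClass χ j := hij ▸ hv
  rw [← mem_colorClass.1 hv, mem_colorClass.1 hv']

lemma isRQPartition_colorPartition {G : SimpleGraph V} {q r : ℕ} {χ : V → I}
    (hχ : ∀ i, (colorClass χ i).Nonempty) (h : FamilyDegreesMod G q r (colorClass χ)) :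
    IsRQPartition G r q (colorPartition χ hχ) := by
  classical
  intro A hA
  obtain ⟨i, rfl⟩ := mem_parts_colorPartition.1 hA
  rintro ⟨v, hv⟩
  rw [← ZMod.natCast_eq_natCast_iff, ← h i v hv]
  congr 1
  rw [← SimpleGraph.card_neighborFinset_eq_degree]
  refine Finset.card_bij (fun u _ => u.1) ?_ ?_ ?_
  · rintro ⟨u, hu⟩ h'
    rw [SimpleGraph.mem_neighborFinset] at h'
    rw [Finset.mem_filter]
    exact ⟨hu, h'⟩
  · intro a _ b _ hab
    exact Subtype.ext hab
  · intro u hu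
    rw [Finset.mem_filter] at hu
    exact ⟨⟨u, hu.1⟩, by rw [SimpleGraph.mem_neighborFinset]; exact hu.2, rfl⟩

/-- The `t` multiples of `d` that add up to `d * k` and are as equal as possible. -/
def balancedSizes (d k t : ℕ) (i : Fin t) : ℕ := d * (k / t + if (i : ℕ) < k % t then 1 else 0)

lemma sum_balancedSizes {d k t : ℕ} (ht : 0 < t) : ∑ i, balancedSizes d k t i = d * k := by
  unfold balancedSizes
  rw [← Finset.mul_sum, Finset.sum_add_distrib, Finset.sum_const, Finset.card_univ,
    Fintype.card_fin, smul_eq_mul, Fin.sum_univ_eq_sum_range (fun i => if i < k % t then 1 else 0) t,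
    ← Finset.card_filter]
  have : ({i ∈ Finset.range t | i < k % t} : Finset ℕ) = Finset.range (k % t) := by
    ext i
    have := Nat.mod_lt k ht
    simp only [Finset.mem_filter, Finset.mem_range]
    omega
  rw [this, Finset.card_range, Nat.div_add_mod]

lemma isNearlyEqual_balancedSizes {d k t : ℕ} (ht : 0 < t) (hd : d ≤ 2) :
    IsNearlyEqual t (d * k) (balancedSizes d k t) := by
  refine ⟨sum_balancedSizes ht, fun i => ?_⟩
  have ht' : (0 : ℝ) < t := by exact_mod_cast ht
  have hd' : (d : ℝ) ≤ 2 := by exact_mod_cast hd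
  have h1 : ((k / t : ℕ) : ℝ) ≤ k / t := Nat.cast_div_le
  have h2 : (k : ℝ) / t < (k / t : ℕ) + 1 := by
    rw [div_lt_iff₀ ht']
    have := Nat.lt_mul_div_succ k ht
    rw [mul_comm] at this
    exact_mod_cast this
  have h3 : |((k / t : ℕ) : ℝ) + (if (i : ℕ) < k % t then 1 else 0) - k / t| ≤ 1 := by
    rw [abs_le]
    split_ifs <;> constructor <;> linarith
  have h4 : ((balancedSizes d k t i : ℕ) : ℝ) - ((d * k : ℕ) : ℝ) / t =
      d * (((k / t : ℕ) : ℝ) + (if (i : ℕ) < k % t then 1 else 0) - k / t) := by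
    unfold balancedSizes
    push_cast
    ring
  rw [h4, abs_mul, Nat.abs_cast]
  nlinarith [abs_nonneg (((k / t : ℕ) : ℝ) + (if (i : ℕ) < k % t then 1 else 0) - k / t)]

lemma balancedSizes_eq_or {d k t : ℕ} (hd : 0 < d) (ht : 0 < t) (i : Fin t) :
    balancedSizes d k t i = d * ⌊((d * k : ℕ) : ℚ) / (d * t)⌋₊ ∨
      balancedSizes d k t i = d * ⌈((d * k : ℕ) : ℚ) / (d * t)⌉₊ := by
  have hd' : (d : ℚ) ≠ 0 := by exact_mod_cast hd.ne'
  have ht' : (0 : ℚ) < t := by exact_mod_cast ht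
  have h1 : ((d * k : ℕ) : ℚ) / (d * t) = k / t := by
    push_cast
    exact mul_div_mul_left _ _ hd'
  rw [h1, Rat.natFloor_natCast_div_natCast]
  unfold balancedSizes
  -- A class of size `d * (k / t + 1)` occurs only if `t ∤ k`, where this is the rounded-up size.
  split_ifs with h
  · right
    congr 1
    symm
    rw [Nat.ceil_eq_iff (Nat.add_one_ne_zero _), Nat.add_sub_cancel, lt_div_iff₀ ht', div_le_iff₀ ht']
    have h2 := Nat.div_add_mod k t
    have h3 := Nat.mod_lt k ht
    have h4 : 0 < k % t := (Nat.zero_le _).trans_lt h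
    constructor
    · have : k / t * t < k := by linarith
      exact_mod_cast this
    · have : k ≤ (k / t + 1) * t := by linarith
      exact_mod_cast this
  · left; rfl

end Transfer

theorem theorem3 (q r : ℕ) (hq : 2 ≤ q) (hr : r < q) :
    Tendsto
      (fun n : ℕ => randomGraphHalf n
        {G | ∃ P : Finpartition (Finset.univ : Finset (Fin n)),
          #P.parts = q + 1 ∧ IsRQPartition G r q P ∧ IsBalancedPartition (parityStep q r) P})
      (atTop ⊓ 𝓟 {n : ℕ | Even q → Odd r → Even n}) (𝓝 1) ∧
    Tendsto
      (fun n : ℕ => randomGraphHalf n {G | partitionNumber G r q ≤ (q + 1 : ℕ)})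
      (atTop ⊓ 𝓟 {n : ℕ | Even q → Odd r → Even n}) (𝓝 1) := by
  have hprob : ∀ n, MeasureTheory.IsProbabilityMeasure (randomGraphHalf n) := fun n => by
    unfold randomGraphHalf; infer_instance
  have hd0 : 0 < parityStep q r := by unfold parityStep; split_ifs <;> norm_num
  have hd2 : parityStep q r ≤ 2 := by unfold parityStep; split_ifs <;> norm_num
  have main : Tendsto
      (fun n : ℕ => randomGraphHalf n
        {G | ∃ P : Finpartition (Finset.univ : Finset (Fin n)),
          #P.parts = q + 1 ∧ IsRQPartition G r q P ∧ IsBalancedPartition (parityStep q r) P})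
      (atTop ⊓ 𝓟 {n : ℕ | Even q → Odd r → Even n}) (𝓝 1) := by
    refine tendsto_order.2 ⟨fun a ha => ?_, fun a ha =>
      Eventually.of_forall fun n => MeasureTheory.prob_le_one.trans_lt ha⟩
    obtain ⟨κ, hκ1, hκ2⟩ : ∃ κ, a.toReal < κ ∧ κ < 1 := exists_between (by
      rw [← ENNReal.toReal_one]
      exact ENNReal.toReal_strict_mono ENNReal.one_ne_top ha)
    rw [eventually_inf_principal]
    filter_upwards [eventually_le_graphProb_coloring (r := r) hq hκ2,
      eventually_ge_atTop (3 * (q + 1))] with n hn hlarge hpar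
    obtain ⟨k, hk⟩ : parityStep q r ∣ n := by
      unfold parityStep
      split_ifs with h
      · exact (hpar h.1 h.2).two_dvd
      · exact one_dvd n
    have hm : IsNearlyEqual (q + 1) n (balancedSizes (parityStep q r) k (q + 1)) := by
      conv => arg 2; rw [hk]
      exact isNearlyEqual_balancedSizes (Nat.succ_pos q) hd2
    have h1 := hn _ hm fun hqe hro i => by
      have : parityStep q r = 2 := if_pos ⟨hqe, hro⟩
      rw [balancedSizes, this]
      exact even_two_mul _
    refine lt_of_lt_of_le ((ENNReal.lt_ofReal_iff_toReal_lt ha.ne_top).2 (hκ1.trans_le h1)) ?_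
    rw [← randomGraphHalf_apply]
    refine MeasureTheory.measure_mono ?_
    rintro G ⟨χ, hχ, hG⟩
    rw [mem_coloringsOfSizes] at hχ
    have hne : ∀ i, (colorClass χ i).Nonempty := by
      intro i
      rw [← Finset.card_pos, hχ i]
      have h2 := hm.sub_le i
      have h3 : (3 : ℝ) ≤ n / (q + 1 : ℕ) := by
        rw [le_div_iff₀ (by positivity)]
        exact_mod_cast hlarge
      have h4 : (0 : ℝ) < balancedSizes (parityStep q r) k (q + 1) i := by linarith
      exact_mod_cast h4
    have hcard : #(colorPartition χ hne).parts = q + 1 := by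
      rw [card_parts_colorPartition, Fintype.card_fin]
    refine ⟨colorPartition χ hne, hcard, isRQPartition_colorPartition hne hG, fun A hA => ?_⟩
    obtain ⟨i, rfl⟩ := mem_parts_colorPartition.1 hA
    rw [hχ i, hcard, Fintype.card_fin]
    have h5 := balancedSizes_eq_or (k := k) hd0 (Nat.succ_pos q) i
    rwa [← hk] at h5
  refine ⟨main, tendsto_of_tendsto_of_tendsto_of_le_of_le main tendsto_const_nhds
    (fun n => MeasureTheory.measure_mono ?_) fun n => MeasureTheory.prob_le_one⟩
  rintro G ⟨P, hP, hG, -⟩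
  change partitionNumber G r q ≤ _
  rw [partitionNumber]
  exact sInf_le ⟨P, hG, by rw [hP]⟩
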